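/- **Setting.** Let $(M,D,g)$ be a sub-Riemannian manifold: $M$ is a smooth, connected, simply connected manifold (Hausdorff, second countable, finite-dimensional, without boundary), $D\subseteq TM$ is a smooth subbundle whose sections and their iterated Lie brackets span every tangent space, and $g$ is a smooth metric tensor on $D$. Let $D$ have rank $k\ge 2$. Let $\mathfrak g$ be a finite-dimensional real Lie algebra and $\mathfrak e\subseteq\mathfrak g$ a linear subspace of positive codimension that generates $\mathfrak g$ as a Lie algebra. Let $\mathcal A\subseteq\Omega^1(M,\mathfrak g)$ be the set of smooth $\mathfrak g$-valued one-forms $\alpha$ with $d\alpha+\frac12[\alpha,\alpha]=0$, where $\frac12[\alpha,\alpha](v,w)=[\alpha(v),\alpha(w)]$. For $\alpha\in\mathcal A$ let $T_\alpha\mathcal A$ be the set of all derivatives $\dot\beta(0)$ of smooth curves $\beta:(-\varepsilon,\varepsilon)\to\Omega^1(M,\mathfrak g)$, $\varepsilon>0$, with $\beta(0)=\alpha$ and $\beta(t)\in\mathcal A$ for all $t$. Let $P:\Omega^1(M,\mathfrak g)\to\Omega^1(D,\mathfrak g/\mathfrak e)=\Gamma(D^*\otimes\mathfrak g/\mathfrak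 e)$ (smooth sections) be the linear map $P(\alpha)=\alpha|_D \bmod \mathfrak e$. A form $\alpha\in\mathcal A$ with $\alpha(D)\subseteq\mathfrak e$ is called *regular* if the differential of $P|_{\mathcal A}$ at $\alpha$, that is, $P:T_\alpha\mathcal A\to\Omega^1(D,\mathfrak g/\mathfrak e)$, is surjective, and *singular* otherwise. The subspace $\mathfrak e$ is *strongly $q$-bracket generating* if for all $1\le l\le q$, all linearly independent $A_1,\dots,A_l\in\mathfrak e$ and all $Z_1,\dots,Z_l\in\mathfrak g$ there is $B\in\mathfrak e$ with $Z_j-[A_j,B]\in\mathfrak e$ for $j=1,\dots,l$. A curve $\gamma:[0,1]\to M$ is *horizontal* if it is absolutely continuous with $\dot\gamma(t)\in D_{\gamma(t)}$ for almost every $t$. **Proposition.** Let $\alpha\in\mathcal A$ satisfy $\alpha(D)\subseteq\mathfrak e$. (a) If there is a horizontal loop $\gamma:[0,1]\to M$, $\gamma(0)=\gamma(1)$, without self-intersections ($\gamma$ is injective on $[0,1)$), such that $\alpha(\dot\gamma(t))=0$ for almost every $t\in[0,1]$, then $\alpha$ is singular. (b) If $\mathfrak e$ is strongly $k$-bracket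 generating and $\alpha|_{D_x}:D_x\to\mathfrak e$ is injective for every $x\in M$, then $\alpha$ is regular. -/

import Mathlib

open Set MeasureTheory Bundle
open scoped Manifold ContDiff

noncomputable section

namespace HorizontalForms

/-! ### Lie algebras -/

/-- A Lie ring carrying a norm for its additive group. No relation between norm and bracket is
required: on the finite-dimensional Lie algebras considered below the norm only serves to speak
about smooth maps, and the notion of smoothness does not depend on it. -/
class NormedLieRing (L : Type*) extends NormedAddCommGroup L, LieRing L

/-- A real Lie algebra whose underlying vector space is a normed space. -/
class NormedLieAlgebra (L : Type*) [NormedLieRing L] extends NormedSpace ℝ L, LieAlgebra ℝ L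

/-- The subspace `𝔢` generates `L` as a Lie algebra. -/
def IsGenerating {L : Type*} [LieRing L] [LieAlgebra ℝ L] (𝔢 : Submodule ℝ L) : Prop :=
  LieSubalgebra.lieSpan ℝ L (𝔢 : Set L) = ⊤

/-- The subspace `𝔢` is strongly `q`-bracket generating: for `1 ≤ l ≤ q`, linearly independent
`A₁, …, A_l ∈ 𝔢` and any `Z₁, …, Z_l ∈ L`, some `B ∈ 𝔢` satisfies `Z_j - [A_j, B] ∈ 𝔢`
for all `j`. -/
def IsStronglyBracketGenerating {L : Type*} [LieRing L] [LieAlgebra ℝ L]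
    (q : ℕ) (𝔢 : Submodule ℝ L) : Prop :=
  ∀ l : ℕ, 1 ≤ l → l ≤ q → ∀ A : Fin l → L, (∀ j, A j ∈ 𝔢) → LinearIndependent ℝ A →
    ∀ Z : Fin l → L, ∃ B ∈ 𝔢, ∀ j, Z j - ⁅A j, B⁆ ∈ 𝔢

section Manifold

variable {m : ℕ} {M : Type*} [TopologicalSpace M] [ChartedSpace (EuclideanSpace ℝ (Fin m)) M]
  [IsManifold (𝓡 m) ∞ M]

/-! ### Sub-Riemannian structures -/

/-- A smooth vector field on `M`. -/
def IsSmoothField (X : ∀ x : M, TangentSpace (𝓡 m) x) : Prop :=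
  ContMDiff (𝓡 m) (𝓡 m).tangent ∞ (fun x ↦ (⟨x, X x⟩ : TangentBundle (𝓡 m) M))

/-- Smooth sections of a family `D` of subspaces of the tangent spaces, and their iterated
Lie brackets. -/
inductive IsIteratedBracket (D : ∀ x : M, Submodule ℝ (TangentSpace (𝓡 m) x)) :
    (∀ x : M, TangentSpace (𝓡 m) x) → Prop
  | of_section (X : ∀ x : M, TangentSpace (𝓡 m) x) (hX : IsSmoothField X)
      (hD : ∀ x, X x ∈ D x) : IsIteratedBracket D X
  | bracket (X Y : ∀ x : M, TangentSpace (𝓡 m) x) (hX : IsIteratedBracket D X)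
      (hY : IsIteratedBracket D Y) :
      IsIteratedBracket D (VectorField.mlieBracket (𝓡 m) X Y)

variable (m M) in
/-- A sub-Riemannian structure `(D, g)` of rank `k` on `M`: a smooth subbundle `D` of rank `k`
of the tangent bundle which is bracket generating, with a smooth positive definite
symmetric metric tensor `g` on `D`. -/
structure SubRiemannianStructure (k : ℕ) where
  /-- The fibres of the subbundle. -/
  D : ∀ x : M, Submodule ℝ (TangentSpace (𝓡 m) x)
  /-- Near every point, `D` has a smooth frame consisting of `k` vector fields. -/
  exists_frame : ∀ x₀ : M, ∃ U : Set M, IsOpen U ∧ x₀ ∈ U ∧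
    ∃ X : Fin k → ∀ x : M, TangentSpace (𝓡 m) x,
      (∀ i, ContMDiffOn (𝓡 m) (𝓡 m).tangent ∞
        (fun x ↦ (⟨x, X i x⟩ : TangentBundle (𝓡 m) M)) U) ∧
      ∀ x ∈ U, LinearIndependent ℝ (fun i ↦ X i x) ∧
        Submodule.span ℝ (range fun i ↦ X i x) = D x
  /-- The sections of `D` and their iterated brackets span every tangent space. -/
  bracketGenerating : ∀ x : M,
    Submodule.span ℝ {v : TangentSpace (𝓡 m) x | ∃ X, IsIteratedBracket D X ∧ X x = v} = ⊤
  /-- The metric on the fibres of `D`. -/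
  g : ∀ x : M, D x →ₗ[ℝ] D x →ₗ[ℝ] ℝ
  g_symm : ∀ x v w, g x v w = g x w v
  g_pos : ∀ x v, v ≠ 0 → 0 < g x v v
  g_smooth : ∀ X Y : ∀ x : M, D x, IsSmoothField (fun x ↦ (X x : TangentSpace (𝓡 m) x)) →
    IsSmoothField (fun x ↦ (Y x : TangentSpace (𝓡 m) x)) →
    ContMDiff (𝓡 m) 𝓘(ℝ, ℝ) ∞ (fun x ↦ g x (X x) (Y x))

/-! ### Horizontal curves, parametrized by `[0, 1]` -/

/-- The velocity vector of a curve. -/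
def velocity (γ : ℝ → M) (t : ℝ) : TangentSpace (𝓡 m) (γ t) :=
  mfderiv 𝓘(ℝ, ℝ) (𝓡 m) γ t (1 : ℝ)

variable (m) in
/-- Absolute continuity on `[0, 1]` of a curve in `M`: `γ` is continuous and `f ∘ γ` is
absolutely continuous for every smooth function `f` on `M`. -/
def IsAbsolutelyContinuousCurve (γ : ℝ → M) : Prop :=
  ContinuousOn γ (Icc 0 1) ∧ ∀ f : M → ℝ, ContMDiff (𝓡 m) 𝓘(ℝ, ℝ) ∞ f →
    AbsolutelyContinuousOnInterval (f ∘ γ) 0 1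

/-- `γ : [0, 1] → M` is horizontal: it is absolutely continuous and, for almost every `t`, it is
differentiable at `t` with velocity in `D`. (Almost everywhere differentiability is automatic
for absolutely continuous curves.) -/
def IsHorizontalCurve (D : ∀ x : M, Submodule ℝ (TangentSpace (𝓡 m) x)) (γ : ℝ → M) : Prop :=
  IsAbsolutelyContinuousCurve m γ ∧
  ∀ᵐ t ∂(volume.restrict (Icc (0 : ℝ) 1)),
    MDifferentiableAt 𝓘(ℝ, ℝ) (𝓡 m) γ t ∧ velocity (m := m) γ t ∈ D (γ t)

/-- The curve `γ : [0, 1] → M` is a loop that only meets itself at its endpoints. -/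
def IsSimpleLoop (γ : ℝ → M) : Prop :=
  γ 0 = γ 1 ∧ InjOn γ (Ico 0 1)

/-! ### Forms with values in a Lie algebra -/

variable {𝔤 : Type*} [NormedLieRing 𝔤] [NormedLieAlgebra 𝔤]

variable (m M 𝔤) in
/-- A (not necessarily smooth) one-form on `M` with values in `𝔤`. -/
abbrev RoughOneForm : Type _ := ∀ x : M, TangentSpace (𝓡 m) x →L[ℝ] 𝔤

/-- Smooth one-forms: the space `Ω¹(M, 𝔤)`. -/
def IsSmoothOneForm (α : RoughOneForm m M 𝔤) : Prop :=
  ContMDiff (𝓡 m) ((𝓡 m).prod 𝓘(ℝ, EuclideanSpace ℝ (Fin m) →L[ℝ] 𝔤)) ∞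
    (fun x ↦ (⟨x, α x⟩ : TotalSpace (EuclideanSpace ℝ (Fin m) →L[ℝ] 𝔤)
      (fun x : M ↦ TangentSpace (𝓡 m) x →L[ℝ] Trivial M 𝔤 x)))

/-- The derivative of a `𝔤`-valued function along a tangent vector. -/
def dirDeriv (F : M → 𝔤) (x : M) (v : TangentSpace (𝓡 m) x) : 𝔤 :=
  mfderiv (𝓡 m) 𝓘(ℝ, 𝔤) F x v

/-- The exterior derivative `dα(X, Y) = X(α(Y)) - Y(α(X)) - α([X, Y])` of a one-form. -/
def extDerivOneForm (α : RoughOneForm m M 𝔤) (X Y : ∀ x : M, TangentSpace (𝓡 m) x) (x : M) : 𝔤 :=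
  dirDeriv (fun y ↦ α y (Y y)) x (X x) - dirDeriv (fun y ↦ α y (X y)) x (Y x) -
    α x (VectorField.mlieBracket (𝓡 m) X Y x)

/-- The space `𝒜` of smooth solutions to the left Maurer-Cartan equation `dα + ½[α, α] = 0`, where
`½[α, α](v, w) = [α(v), α(w)]`. -/
def MaurerCartanForms : Set (RoughOneForm m M 𝔤) :=
  {α | IsSmoothOneForm α ∧
    ∀ X Y : ∀ x : M, TangentSpace (𝓡 m) x, IsSmoothField X → IsSmoothField Y →
      ∀ x, extDerivOneForm α X Y x + ⁅α x (X x), α x (Y x)⁆ = 0}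

/-- The elements of `𝒜` that map `D` into `𝔢`. -/
def HorizontalMaurerCartanForms
    (D : ∀ x : M, Submodule ℝ (TangentSpace (𝓡 m) x)) (𝔢 : Submodule ℝ 𝔤) :
    Set (RoughOneForm m M 𝔤) :=
  {α | α ∈ MaurerCartanForms ∧ ∀ x, ∀ v ∈ D x, α x v ∈ 𝔢}

/-- The family `β t`, `|t| < ε`, of one-forms is a smooth curve in `Ω¹(M, 𝔤)`, i.e. it is smooth
jointly in `t` and the point of `M`. -/
def IsSmoothCurveOfForms (ε : ℝ) (β : ℝ → RoughOneForm m M 𝔤) : Prop :=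
  ContMDiffOn (𝓘(ℝ, ℝ).prod (𝓡 m)) ((𝓡 m).prod 𝓘(ℝ, EuclideanSpace ℝ (Fin m) →L[ℝ] 𝔤)) ∞
    (fun p : ℝ × M ↦ (⟨p.2, β p.1 p.2⟩ : TotalSpace (EuclideanSpace ℝ (Fin m) →L[ℝ] 𝔤)
      (fun x : M ↦ TangentSpace (𝓡 m) x →L[ℝ] Trivial M 𝔤 x)))
    (Ioo (-ε) ε ×ˢ univ)

/-- The tangent space `T_α 𝒜`: the derivatives at `0` of the smooth curves `β` in `Ω¹(M, 𝔤)`,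
defined on some `(-ε, ε)`, with values in `𝒜` and with `β 0 = α`. -/
def tangentMaurerCartan (α : RoughOneForm m M 𝔤) :
    Set (RoughOneForm m M 𝔤) :=
  {η | ∃ ε : ℝ, 0 < ε ∧ ∃ β : ℝ → RoughOneForm m M 𝔤, IsSmoothCurveOfForms ε β ∧ β 0 = α ∧
    (∀ t ∈ Ioo (-ε) ε, β t ∈ MaurerCartanForms) ∧
    ∀ (x : M) (v : TangentSpace (𝓡 m) x), HasDerivAt (fun t ↦ β t x v) (η x v) 0}

/-! ### The map `P`, regular and singular forms -/

/-- The smooth partial one-forms `Ω¹(D, 𝔤/𝔢)`, i.e. the smooth sections of `D* ⊗ (𝔤/𝔢)`: families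
of linear maps `D x → 𝔤/𝔢` whose values on smooth sections of `D` have smooth components. -/
def IsSmoothPartialForm (D : ∀ x : M, Submodule ℝ (TangentSpace (𝓡 m) x)) (𝔢 : Submodule ℝ 𝔤)
    (φ : ∀ x : M, D x →ₗ[ℝ] 𝔤 ⧸ 𝔢) : Prop :=
  ∀ X : ∀ x : M, D x, IsSmoothField (fun x ↦ (X x : TangentSpace (𝓡 m) x)) →
    ∀ c : (𝔤 ⧸ 𝔢) →ₗ[ℝ] ℝ, ContMDiff (𝓡 m) 𝓘(ℝ, ℝ) ∞ (fun x ↦ c (φ x (X x)))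

/-- The linear map `P(α) = α|D mod 𝔢`. -/
def restrictMod (D : ∀ x : M, Submodule ℝ (TangentSpace (𝓡 m) x)) (𝔢 : Submodule ℝ 𝔤)
    (α : RoughOneForm m M 𝔤) (x : M) : D x →ₗ[ℝ] 𝔤 ⧸ 𝔢 :=
  𝔢.mkQ ∘ₗ (α x : TangentSpace (𝓡 m) x →ₗ[ℝ] 𝔤) ∘ₗ (D x).subtype

/-- `α` is regular: the differential at `α` of the restriction of `P` to `𝒜` maps `T_α 𝒜` onto
`Ω¹(D, 𝔤/𝔢)`. As `P` is linear, its differential is `P` itself. -/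
def IsRegular (D : ∀ x : M, Submodule ℝ (TangentSpace (𝓡 m) x))
    (𝔢 : Submodule ℝ 𝔤) (α : RoughOneForm m M 𝔤) : Prop :=
  ∀ φ : ∀ x : M, D x →ₗ[ℝ] 𝔤 ⧸ 𝔢, IsSmoothPartialForm D 𝔢 φ →
    ∃ η ∈ tangentMaurerCartan α, restrictMod D 𝔢 η = φ

/-- `α` is singular: the differential at `α` of the restriction of `P` to `𝒜` is not onto. -/
def IsSingular (D : ∀ x : M, Submodule ℝ (TangentSpace (𝓡 m) x))
    (𝔢 : Submodule ℝ 𝔤) (α : RoughOneForm m M 𝔤) : Prop :=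
  ¬ IsRegular D 𝔢 α

end Manifold

end HorizontalForms

end

/-! Both parts rest on a description of the tangent space of $\mathcal A$ by infinitesimal gauge
transformations $df+[\alpha,f]$, with $f:M\to\mathfrak g$ smooth.

Every such form is tangent. The curve $b(t)$ with $b'=df-[f,b]$, $b(0)=\alpha$ is the gauge orbit of
$\alpha$ under $\exp(tf)$. Its Maurer-Cartan expression $F$ satisfies $F'=-[f,F]$ and hence stays
zero (`gaugeVariation_mem_tangent`).

Conversely, on a simply connected $M$ every tangent vector has this form
(`exists_eq_gaugeVariation`). A tangent vector $\eta$ solves the linearized equation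
$d\eta+[\alpha,\eta]=0$, where $[\alpha,\eta](v,w)=[\alpha(v),\eta(w)]+[\eta(v),\alpha(w)]$.
Together with the equation for $\alpha$ this says that the affine system $df=\eta-[\alpha,f]$ is
flat. Flat linear systems are solved locally by integrating along rays (`exists_local_solution`).
Two invertible local solutions differ by a locally constant factor, so they define a covering space
of $M$, which has a global section (`exists_parallel_section`).

Part (b). If $f$ takes values in $\mathfrak e$, so does $df$, and $P(df+[\alpha,f])$ is
$[\alpha,f]|_D$ modulo $\mathfrak e$. For given $\varphi$ it remains to solve
$[\alpha(v),f]\equiv\varphi(v)$ with $f\in\mathfrak e$. At each point this is strong bracket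
generation applied to the images under $\alpha$ of a basis of $D_x$. Surjectivity gives smooth local
solutions, and the solution sets are convex, so a partition of unity glues them.

Part (a). Along a loop $\gamma$ with $\alpha(\dot\gamma)=0$ the bracket term vanishes, so
$\eta(\dot\gamma)=(f\circ\gamma)'$ integrates to zero for every tangent $\eta$. This constrains the
image of $P$. If $P$ were onto, then $\int h(\gamma)\,(g\circ\gamma)'\,dt=0$ for all smooth
functions $g,h$. As $\gamma$ is simple, functions $h\circ\gamma$ approximate the indicator of
$[1/3,2/3]$. This forces $g(\gamma(1/3))=g(\gamma(2/3))$ for every $g$, which is absurd. -/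

namespace HorizontalForms

open Filter Topology unitInterval BoundedContinuousFunction

/-! ### Maps into spaces of continuous functions -/

section Parametric

universe u v

/-- A bilinear map applied pointwise to a continuous function and a vector. -/
noncomputable def applyCurve {E G W : Type*} [NormedAddCommGroup E] [NormedSpace ℝ E]
    [NormedAddCommGroup G] [NormedSpace ℝ G] [NormedAddCommGroup W] [NormedSpace ℝ W]
    (Λ : G →L[ℝ] E →L[ℝ] W) : (I →ᵇ G) →L[ℝ] E →L[ℝ] (I →ᵇ W) :=
  LinearMap.mkContinuous₂
    (LinearMap.mk₂ ℝ (fun (u : (I →ᵇ G)) (h : E) ↦ mkOfCompact ⟨fun s ↦ Λ (u s) h, by fun_prop⟩)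
      (fun u u' h ↦ by ext s; simp) (fun c u h ↦ by ext s; simp)
      (fun u h h' ↦ by ext s; simp)
      (fun c u h ↦ by ext s; simp))
    ‖Λ‖ fun u h ↦ by
      refine (BoundedContinuousFunction.norm_le (by positivity)).2 fun s ↦ ?_
      exact (Λ.le_opNorm₂ (u s) h).trans (by gcongr; exact u.norm_coe_le_norm s)

@[simp] lemma applyCurve_apply {E G W : Type*} [NormedAddCommGroup E] [NormedSpace ℝ E]
    [NormedAddCommGroup G] [NormedSpace ℝ G] [NormedAddCommGroup W] [NormedSpace ℝ W]
    (Λ : G →L[ℝ] E →L[ℝ] W) (u : (I →ᵇ G)) (h : E) (s : I) :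
    applyCurve Λ u h s = Λ (u s) h := rfl

/-- The curve `s ↦ a (s, x)` on the unit interval. -/
def paramCurve {E W : Type*} [TopologicalSpace E]
    [PseudoMetricSpace W] (a : ℝ × E → W) (ha : Continuous a) (x : E) :
    (I →ᵇ W) := mkOfCompact ⟨fun s ↦ a (s, x), by fun_prop⟩

@[simp] lemma paramCurve_apply {E W : Type*} [TopologicalSpace E]
    [PseudoMetricSpace W] (a : ℝ × E → W) (ha : Continuous a) (x : E) (s : I) :
    paramCurve a ha x s = a (s, x) := rfl

lemma continuous_paramCurve {E W : Type*} [TopologicalSpace E]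
    [PseudoMetricSpace W] (a : ℝ × E → W) (ha : Continuous a) : Continuous (paramCurve a ha) :=
  (ContinuousMap.isometryEquivBoundedOfCompact I W).continuous.comp
    (ContinuousMap.curry ⟨fun p : E × I ↦ a (p.2, p.1), by fun_prop⟩).continuous

/-- The mean value inequality on a small ball gives a remainder estimate uniform in `s`, because `a'
(s, ·)` is continuous in `x` uniformly over the compact interval. -/
lemma hasFDerivAt_paramCurve {E G W : Type*} [NormedAddCommGroup E] [NormedSpace ℝ E]
    [NormedAddCommGroup G] [NormedSpace ℝ G] [NormedAddCommGroup W] [NormedSpace ℝ W]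
    (Λ : G →L[ℝ] E →L[ℝ] W) (a : ℝ × E → W) (ha : Continuous a) (a' : ℝ × E → G)
    (ha' : Continuous a')
    (h : ∀ s x, HasFDerivAt (fun y ↦ a (s, y)) (Λ (a' (s, x))) x) (x : E) :
    HasFDerivAt (paramCurve a ha) (applyCurve Λ (paramCurve a' ha' x)) x := by
  rw [hasFDerivAt_iff_isLittleO, Asymptotics.isLittleO_iff]
  intro ε hε
  -- Closeness of the curves `a' (·, z)` within this bound makes the derivatives `Λ (a' (s, z))`
  -- differ by at most `ε`; the `+ 1` covers `Λ = 0`.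
  have hε' : 0 < ε / (‖Λ‖ + 1) := by positivity
  have hc := (continuous_paramCurve a' ha').continuousAt (x := x)
  obtain ⟨δ, hδ, hb⟩ := Metric.continuousAt_iff.1 hc _ hε'
  filter_upwards [Metric.ball_mem_nhds x hδ] with y hy
  refine (BoundedContinuousFunction.norm_le (by positivity)).2 fun s ↦ ?_
  have := Convex.norm_image_sub_le_of_norm_hasFDerivWithin_le' (𝕜 := ℝ)
    (f := fun y ↦ a (s, y)) (f' := fun y ↦ Λ (a' (s, y))) (φ := Λ (a' (s, x))) (C := ε)
    (s := Metric.ball x δ) (x := x) (y := y)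
    (fun z _ ↦ (h s z).hasFDerivWithinAt) (fun z hz ↦ ?_) (convex_ball _ _)
    (Metric.mem_ball_self hδ) hy
  · simpa using this
  · have h1 := (hb hz).le
    rw [dist_eq_norm] at h1
    have h2 : ‖a' (s, z) - a' (s, x)‖ ≤ ε / (‖Λ‖ + 1) :=
      ((paramCurve a' ha' z - paramCurve a' ha' x).norm_coe_le_norm s).trans h1
    rw [← map_sub]
    calc ‖Λ (a' (s, z) - a' (s, x))‖ ≤ ‖Λ‖ * (ε / (‖Λ‖ + 1)) :=
          (Λ.le_opNorm _).trans (by gcongr)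
      _ ≤ (‖Λ‖ + 1) * (ε / (‖Λ‖ + 1)) := by gcongr; linarith
      _ = ε := by field_simp

/-- Induction on the order: the derivative is again a parametric curve, formed from the partial
derivative in `x`, followed by a bounded linear map. The new curve has values in `E →L[ℝ] W`, so the
target is quantified inside the induction and its universe contains that of `E`. -/
lemma contDiff_paramCurve_nat {E : Type u} [NormedAddCommGroup E] [NormedSpace ℝ E] (n : ℕ) :
    ∀ {W : Type (max u v)} [NormedAddCommGroup W] [NormedSpace ℝ W] (a : ℝ × E → W)
      (ha : ContDiff ℝ ∞ a), ContDiff ℝ n (paramCurve a ha.continuous) := by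
  induction n with
  | zero =>
    intro W _ _ a ha
    exact contDiff_zero.2 (continuous_paramCurve a ha.continuous)
  | succ n ih =>
    intro W _ _ a ha
    obtain ⟨G, _, _, Λ, a', ha', h⟩ : ∃ (G : Type (max u v)) (_ : NormedAddCommGroup G)
        (_ : NormedSpace ℝ G) (Λ : G →L[ℝ] E →L[ℝ] W) (a' : ℝ × E → G), ContDiff ℝ ∞ a' ∧
        ∀ s x, HasFDerivAt (fun y ↦ a (s, y)) (Λ (a' (s, x))) x := by
      refine ⟨E →L[ℝ] W, inferInstance, inferInstance, ContinuousLinearMap.id ℝ _,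
        fun p : ℝ × E ↦ (fderiv ℝ a p).comp (ContinuousLinearMap.inr ℝ ℝ E),
        (ha.fderiv_right (m := ∞) (by simp)).clm_comp contDiff_const, fun s x ↦ ?_⟩
      have h1 : HasFDerivAt a (fderiv ℝ a (s, x)) (s, x) :=
        (ha.differentiable (by simp) _).hasFDerivAt
      exact h1.comp x (hasFDerivAt_prodMk_right s x)
    refine contDiff_succ_iff_hasFDerivAt.2
      ⟨fun x ↦ applyCurve Λ (paramCurve a' ha'.continuous x), ?_, fun x ↦ ?_⟩
    · exact (applyCurve Λ).contDiff.comp (ih a' ha')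
    · exact hasFDerivAt_paramCurve Λ a ha.continuous a' ha'.continuous h x

/-- A smooth map `a` of two variables gives a smooth map `x ↦ a (·, x)` into a space of
continuous functions. -/
lemma contDiff_paramCurve {E : Type u} [NormedAddCommGroup E] [NormedSpace ℝ E]
    {W : Type (max u v)} [NormedAddCommGroup W] [NormedSpace ℝ W] (a : ℝ × E → W)
    (ha : ContDiff ℝ ∞ a) : ContDiff ℝ ∞ (paramCurve a ha.continuous) :=
  contDiff_infty.2 fun n ↦ contDiff_paramCurve_nat n a ha

end Parametric

/-! ### Integration as an operator on continuous functions -/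

section Integration


lemma continuous_projIcc_comp {A : Type*} [PseudoMetricSpace A] (u : (I →ᵇ A)) :
    Continuous fun s : ℝ ↦ u (projIcc 0 1 zero_le_one s) :=
  u.continuous.comp continuous_projIcc

/-- The primitive vanishing at `0` of a continuous function on the unit interval. -/
noncomputable def primitiveL (A : Type*) [NormedAddCommGroup A] [NormedSpace ℝ A] :
    (I →ᵇ A) →L[ℝ] (I →ᵇ A) :=
  LinearMap.mkContinuous
    { toFun u := mkOfCompact ⟨fun t ↦ ∫ s in (0 : ℝ)..t, u (projIcc 0 1 zero_le_one s),
        (intervalIntegral.continuous_primitive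
          (fun _ _ ↦ (continuous_projIcc_comp u).intervalIntegrable _ _) 0).comp
          continuous_subtype_val⟩
      map_add' u v := by
        ext t
        exact intervalIntegral.integral_add ((continuous_projIcc_comp u).intervalIntegrable _ _)
          ((continuous_projIcc_comp v).intervalIntegrable _ _)
      map_smul' c u := by
        ext t
        exact intervalIntegral.integral_smul _ _ }
    1 fun u ↦ by
      rw [one_mul]
      refine (BoundedContinuousFunction.norm_le (by positivity)).2 fun t ↦ ?_
      refine (intervalIntegral.norm_integral_le_of_norm_le_const
        (fun s _ ↦ u.norm_coe_le_norm _)).trans ?_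
      rw [sub_zero, abs_of_nonneg t.2.1]
      exact mul_le_of_le_one_right (norm_nonneg _) t.2.2

end Integration

end HorizontalForms

namespace HorizontalForms

open Filter Topology unitInterval BoundedContinuousFunction

/-! ### Flat linear systems -/

section FlatSystem

universe u v

variable {E : Type u} [NormedAddCommGroup E] [NormedSpace ℝ E]
  {A : Type (max u v)} [NormedRing A] [NormedAlgebra ℝ A] 

/-- The family of operators `u ↦ ∫₀ᵗ θ_{sx}(x) u(s) ds`. -/
noncomputable def radialOp (θ : E → E →L[ℝ] A) (hθ : ContDiff ℝ ∞ θ) (x : E) :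
    (I →ᵇ A) →L[ℝ] (I →ᵇ A) :=
  (primitiveL A).comp (ContinuousLinearMap.mul ℝ (I →ᵇ A)
    (paramCurve (fun p : ℝ × E ↦ θ (p.1 • p.2) p.2)
      (((hθ.continuous.comp (by fun_prop : Continuous fun p : ℝ × E ↦ p.1 • p.2)).clm_apply
        continuous_snd)) x))

lemma radialOp_apply (θ : E → E →L[ℝ] A) (hθ : ContDiff ℝ ∞ θ) (x : E) (u : I →ᵇ A) (t : I) :
    radialOp θ hθ x u t = ∫ s in (0 : ℝ)..t,
      θ (((projIcc 0 1 zero_le_one s : I) : ℝ) • x) x * u (projIcc 0 1 zero_le_one s) := rfl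

lemma contDiff_radialOp (θ : E → E →L[ℝ] A) (hθ : ContDiff ℝ ∞ θ) :
    ContDiff ℝ ∞ (radialOp θ hθ) := by
  have h : ContDiff ℝ ∞ (fun p : ℝ × E ↦ θ (p.1 • p.2) p.2) :=
    (hθ.comp (contDiff_fst.smul contDiff_snd)).clm_apply contDiff_snd
  exact contDiff_const.clm_comp ((ContinuousLinearMap.mul ℝ (I →ᵇ A)).contDiff.comp
    (contDiff_paramCurve.{u, v} _ h))

lemma radialOp_zero (θ : E → E →L[ℝ] A) (hθ : ContDiff ℝ ∞ θ) : radialOp θ hθ 0 = 0 := by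
  ext u t
  simp [radialOp_apply]

/-- If `u` solves the radial equation along the ray through `x`, then `s ↦ u (l s)` solves the
radial equation along the ray through `l x`. -/
lemma radialOp_smul (θ : E → E →L[ℝ] A) (hθ : ContDiff ℝ ∞ θ) (x : E) (u : I →ᵇ A) (l : I)
    (hu : u - radialOp θ hθ x u = 1) :
    u.compContinuous ⟨fun s : I ↦ l * s, by fun_prop⟩ -
      radialOp θ hθ ((l : ℝ) • x) (u.compContinuous ⟨fun s : I ↦ l * s, by fun_prop⟩) = 1 := by
  ext t
  have h1 := congrArg (fun v : I →ᵇ A ↦ v (l * t)) hu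
  simp only [coe_sub, Pi.sub_apply, radialOp_apply, coe_one, Pi.one_apply, compContinuous_apply,
    ContinuousMap.coe_mk] at h1 ⊢
  rw [← h1]
  congr 1
  have h2 := intervalIntegral.smul_integral_comp_mul_left (a := 0) (b := (t : ℝ))
    (fun s ↦ θ (((projIcc 0 1 zero_le_one s : I) : ℝ) • x) x * u (projIcc 0 1 zero_le_one s)) (l : ℝ)
  rw [mul_zero] at h2
  change _ = ∫ s in (0 : ℝ)..(l * t : ℝ), _
  rw [← h2, ← intervalIntegral.integral_smul]
  refine intervalIntegral.integral_congr fun s hs ↦ ?_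
  rw [uIcc_of_le t.2.1] at hs
  have hs1 : s ∈ Icc (0 : ℝ) 1 := ⟨hs.1, hs.2.trans t.2.2⟩
  have hs2 : (l : ℝ) * s ∈ Icc (0 : ℝ) 1 := unitInterval.mul_mem l.2 hs1
  have e1 : projIcc (0 : ℝ) 1 zero_le_one (l * s) = l * ⟨s, hs1⟩ := by
    rw [projIcc_of_mem _ hs2]; rfl
  simp only [projIcc_of_mem _ hs1, e1]
  rw [map_smul, smul_mul_assoc, smul_smul, mul_comm s]
  rfl

/-- The equation `u - K x u = c` for a smooth family `K` of operators vanishing at `0` has a unique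
solution near `0`, and the solution depends smoothly on `x`. -/
lemma exists_smooth_solution_one_sub {E X : Type*} [NormedAddCommGroup E] [NormedSpace ℝ E]
    [NormedAddCommGroup X] [NormedSpace ℝ X] [CompleteSpace X] (K : E → X →L[ℝ] X)
    (hK : ContDiff ℝ ∞ K) (h0 : K 0 = 0) (c : X) :
    ∃ r > 0, ∃ sol : E → X, ContDiffOn ℝ ∞ sol (Metric.ball 0 r) ∧
      ∀ x ∈ Metric.ball (0 : E) r, ∀ u, u - K x u = c ↔ u = sol x := by
  -- On this ball `‖K x‖ < 1`, so `1 - K x` is invertible by the Neumann series; smoothness of the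
  -- solution is smoothness of inversion.
  obtain ⟨r, hr, hball⟩ := Metric.continuousAt_iff.1
    (hK.continuous.continuousAt (x := (0 : E))) 1 zero_lt_one
  have hunit : ∀ x ∈ Metric.ball (0 : E) r, IsUnit (1 - K x) := fun x hx ↦ by
    have := hball hx
    rw [h0, dist_zero_right] at this
    exact isUnit_one_sub_of_norm_lt_one this
  refine ⟨r, hr, fun x ↦ Ring.inverse (1 - K x) c, fun x hx ↦ ?_, fun x hx u ↦ ⟨fun hu ↦ ?_, ?_⟩⟩
  · obtain ⟨U, hU⟩ := hunit x hx
    have h1 : ContDiffAt ℝ ∞ Ring.inverse (1 - K x) := by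
      rw [← hU]; exact contDiffAt_ringInverse ℝ U
    have h2 : ContDiffAt ℝ ∞ (fun y ↦ 1 - K y) x := contDiffAt_const.sub hK.contDiffAt
    exact ((h1.comp x h2).clm_apply contDiffAt_const).contDiffWithinAt
  · have h1 := congrArg (fun T : X →L[ℝ] X ↦ T u) (Ring.inverse_mul_cancel _ (hunit x hx))
    have h2 : (1 - K x) u = c := hu
    change Ring.inverse (1 - K x) ((1 - K x) u) = u at h1
    rw [h2] at h1
    exact h1.symm
  · rintro rfl
    exact congrArg (fun T : X →L[ℝ] X ↦ T c) (Ring.mul_inverse_cancel _ (hunit x hx))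

/-- Along each ray the system is a linear Volterra equation on `[0, 1]`, whose solution curve
depends smoothly on the endpoint `x` of the ray. `Φ x` is the value of that curve at time `1`. -/
lemma exists_radial_solution [CompleteSpace A] (θ : E → E →L[ℝ] A) (hθ : ContDiff ℝ ∞ θ) :
    ∃ r > 0, ∃ Φ : E → A, ContDiffOn ℝ ∞ Φ (Metric.ball 0 r) ∧ Φ 0 = 1 ∧
      ∀ x ∈ Metric.ball (0 : E) r, fderiv ℝ Φ x x = θ x x * Φ x := by
  have hK := contDiff_radialOp.{u, v} θ hθ
  have h0 := radialOp_zero θ hθ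
  obtain ⟨r, hr, sol, hsm, hsol⟩ := exists_smooth_solution_one_sub _ hK h0 1
  let ev : (I →ᵇ A) →L[ℝ] A := evalCLM ℝ 1
  have hsol' : ∀ x ∈ Metric.ball (0 : E) r, sol x - radialOp θ hθ x (sol x) = 1 :=
    fun x hx ↦ (hsol x hx _).2 rfl
  -- By uniqueness, rescaling the solution along the ray to `x` gives the solution along the ray to
  -- `l • x`; so `Φ (l • x)` traces out the whole curve.
  have hray : ∀ x ∈ Metric.ball (0 : E) r, ∀ l : I, ev (sol ((l : ℝ) • x)) = sol x l := by
    intro x hx l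
    have hlx : (l : ℝ) • x ∈ Metric.ball (0 : E) r := by
      rw [mem_ball_zero_iff] at hx ⊢
      rw [norm_smul, Real.norm_of_nonneg l.2.1]
      exact (mul_le_of_le_one_left (norm_nonneg _) l.2.2).trans_lt hx
    rw [← (hsol _ hlx _).1 (radialOp_smul θ hθ x (sol x) l (hsol' x hx))]
    change sol x (l * 1) = _
    rw [mul_one]
  have hint : ∀ x ∈ Metric.ball (0 : E) r, ∀ l : I, sol x l =
      1 + ∫ s in (0 : ℝ)..l, θ (((projIcc 0 1 zero_le_one s : I) : ℝ) • x) x *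
        sol x (projIcc 0 1 zero_le_one s) := by
    intro x hx l
    have h1 := congrArg (fun v : I →ᵇ A ↦ v l) (hsol' x hx)
    rw [← radialOp_apply θ hθ]
    exact sub_eq_iff_eq_add.1 h1
  refine ⟨r, hr, fun x ↦ ev (sol x), ev.contDiff.comp_contDiffOn hsm, ?_, fun x hx ↦ ?_⟩
  · have hx : (0 : E) ∈ Metric.ball (0 : E) r := Metric.mem_ball_self hr
    have := hsol' 0 hx
    rw [h0] at this
    have h2 : sol 0 = 1 := by simpa using this
    change sol 0 1 = 1
    rw [h2]; rfl
  · have hd : HasFDerivAt (fun x ↦ ev (sol x)) (fderiv ℝ (fun x ↦ ev (sol x)) x) ((1 : ℝ) • x) := by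
      rw [one_smul]
      exact ((ev.contDiff.comp_contDiffOn hsm x hx).contDiffAt
        (Metric.isOpen_ball.mem_nhds hx)).differentiableAt
        (by simp) |>.hasFDerivAt
    have hl : HasDerivAt (fun l : ℝ ↦ l • x) x 1 := by
      simpa using (hasDerivAt_id (1 : ℝ)).smul_const x
    -- The integral equation describes `Φ (l • x)` only for `l ≤ 1`, so the derivatives at `l = 1`
    -- are compared within `[0, 1]`.
    have h1 : HasDerivWithinAt (fun l : ℝ ↦ ev (sol (l • x)))
        (fderiv ℝ (fun x ↦ ev (sol x)) x x) (Icc 0 1) 1 := by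
      have := hd.comp_hasDerivAt (1 : ℝ) hl
      exact this.hasDerivWithinAt
    have hcont : Continuous fun s : ℝ ↦ θ (((projIcc 0 1 zero_le_one s : I) : ℝ) • x) x *
        sol x (projIcc 0 1 zero_le_one s) := by
      have hp : Continuous fun s : ℝ ↦ projIcc (0 : ℝ) 1 zero_le_one s := continuous_projIcc
      refine Continuous.mul ?_ ((sol x).continuous.comp hp)
      exact (hθ.continuous.comp ((continuous_subtype_val.comp hp).smul continuous_const)).clm_apply
        continuous_const
    have h2 : HasDerivAt (fun l : ℝ ↦ 1 + ∫ s in (0 : ℝ)..l,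
        θ (((projIcc 0 1 zero_le_one s : I) : ℝ) • x) x * sol x (projIcc 0 1 zero_le_one s))
        (θ (((projIcc (0 : ℝ) 1 zero_le_one 1 : I) : ℝ) • x) x * sol x (projIcc 0 1 zero_le_one 1)) 1 :=
      (intervalIntegral.integral_hasDerivAt_right (hcont.intervalIntegrable _ _)
        hcont.aestronglyMeasurable.stronglyMeasurableAtFilter hcont.continuousAt).const_add 1
    have h3 : HasDerivWithinAt (fun l : ℝ ↦ ev (sol (l • x)))
        (θ (((projIcc (0 : ℝ) 1 zero_le_one 1 : I) : ℝ) • x) x * sol x (projIcc 0 1 zero_le_one 1))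
        (Icc 0 1) 1 := by
      refine h2.hasDerivWithinAt.congr_of_mem (fun l hl ↦ ?_) (by simp)
      exact (hray x hx ⟨l, hl⟩).trans (hint x hx ⟨l, hl⟩)
    have h4 := (uniqueDiffOn_Icc zero_lt_one 1 (by simp)).eq_deriv _ h1 h3
    rw [h4, projIcc_right]
    change θ ((1 : ℝ) • x) x * sol x 1 = _
    rw [one_smul]; rfl

/-- A solution of the radial part of a flat linear system is a solution. -/
lemma fderiv_eq_of_radial (θ : E → E →L[ℝ] A) (hθ : ContDiff ℝ ∞ θ) {r : ℝ}
    (hflat : ∀ x ∈ Metric.ball (0 : E) r, ∀ v w, fderiv ℝ θ x v w - fderiv ℝ θ x w v +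
      θ x w * θ x v - θ x v * θ x w = 0)
    (Φ : E → A) (hΦ : ContDiffOn ℝ ∞ Φ (Metric.ball 0 r))
    (hrad : ∀ x ∈ Metric.ball (0 : E) r, fderiv ℝ Φ x x = θ x x * Φ x)
    (x : E) (hx : x ∈ Metric.ball (0 : E) r) (h : E) : fderiv ℝ Φ x h = θ x h * Φ x := by
  have hat : ∀ y ∈ Metric.ball (0 : E) r, ContDiffAt ℝ ∞ Φ y := fun y hy ↦
    (hΦ y hy).contDiffAt (Metric.isOpen_ball.mem_nhds hy)
  have hd2 : ∀ y ∈ Metric.ball (0 : E) r, HasFDerivAt (fderiv ℝ Φ) (fderiv ℝ (fderiv ℝ Φ) y) y :=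
    fun y hy ↦ (((hat y hy).fderiv_right (m := ∞) (by simp)).differentiableAt
      (by simp)).hasFDerivAt
  have hd1 : ∀ y ∈ Metric.ball (0 : E) r, HasFDerivAt Φ (fderiv ℝ Φ y) y :=
    fun y hy ↦ ((hat y hy).differentiableAt (by simp)).hasFDerivAt
  have hdθ : ∀ y, HasFDerivAt θ (fderiv ℝ θ y) y :=
    fun y ↦ (hθ.differentiable (by simp) y).hasFDerivAt
  -- the derivative of the radial equation
  have hrad' : ∀ y ∈ Metric.ball (0 : E) r, fderiv ℝ (fderiv ℝ Φ) y y h + fderiv ℝ Φ y h =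
      θ y y * fderiv ℝ Φ y h + (fderiv ℝ θ y h y + θ y h) * Φ y := by
    intro y hy
    have e1 := ((hd2 y hy).clm_apply (hasFDerivAt_id y))
    have e2 := ((hdθ y).clm_apply (hasFDerivAt_id y)).mul' (hd1 y hy)
    have e3 : (fun y ↦ fderiv ℝ Φ y (id y)) =ᶠ[𝓝 y] fun y ↦ θ y (id y) * Φ y :=
      Filter.eventually_of_mem (Metric.isOpen_ball.mem_nhds hy) hrad
    have e4 := congrArg (fun T : E →L[ℝ] A ↦ T h) (e1.unique (e2.congr_of_eventuallyEq e3))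
    have hs := (hat y hy).isSymmSndFDerivAt
      (by simpa using WithTop.coe_le_coe.2 (OrderTop.le_top (2 : ℕ∞))) y h
    rw [hs]
    simp only [_root_.add_apply, ContinuousLinearMap.comp_apply,
      ContinuousLinearMap.flip_apply, _root_.smul_apply, id, smul_eq_mul,
      ContinuousLinearMap.id_apply, MulOpposite.smul_eq_mul_unop, MulOpposite.unop_op] at e4
    rw [add_comm, e4, add_comm (θ y h)]
  have hmem : ∀ t ∈ Icc (0 : ℝ) 1, t • x ∈ Metric.ball (0 : E) r := by
    intro t ht
    rw [mem_ball_zero_iff] at hx ⊢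
    rw [norm_smul, Real.norm_of_nonneg ht.1]
    exact (mul_le_of_le_one_left (norm_nonneg _) ht.2).trans_lt hx
  -- The defect of the full equation on the ray, multiplied by `t`. Flatness and the derivative of
  -- the radial equation give `e' = θ (t • x) x * e`; the factor `t` gives `e 0 = 0`, so `e`
  -- vanishes by Grönwall's inequality.
  let e : ℝ → A := fun t ↦ t • (fderiv ℝ Φ (t • x) h - θ (t • x) h * Φ (t • x))
  have hder : ∀ t ∈ Icc (0 : ℝ) 1, HasDerivAt e (θ (t • x) x * e t) t := by
    intro t ht
    have hy := hmem t ht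
    have hl : HasDerivAt (fun l : ℝ ↦ l • x) x t := by
      simpa using (hasDerivAt_id t).smul_const x
    have a1 : HasDerivAt (fun t : ℝ ↦ fderiv ℝ Φ (t • x) h)
        (fderiv ℝ (fderiv ℝ Φ) (t • x) x h) t :=
      (ContinuousLinearMap.apply ℝ A h).hasFDerivAt.comp_hasDerivAt t
        ((hd2 _ hy).comp_hasDerivAt t hl)
    have a2 : HasDerivAt (fun t : ℝ ↦ θ (t • x) h) (fderiv ℝ θ (t • x) x h) t :=
      (ContinuousLinearMap.apply ℝ A h).hasFDerivAt.comp_hasDerivAt t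
        ((hdθ _).comp_hasDerivAt t hl)
    have a3 : HasDerivAt (fun t : ℝ ↦ Φ (t • x)) (fderiv ℝ Φ (t • x) x) t :=
      (hd1 _ hy).comp_hasDerivAt t hl
    have e2 := (hasDerivAt_id t).smul (a1.sub (a2.mul a3))
    convert! e2 using 1
    have f1 := hrad' _ hy
    have f2 := hflat _ hy h (t • x)
    have f3 := hrad _ hy
    simp only [map_smul, _root_.smul_apply, id, one_smul, smul_mul_assoc, mul_smul_comm,
      Pi.sub_apply, Pi.mul_apply] at f1 f2 f3 ⊢
    have g1 : t • fderiv ℝ (fderiv ℝ Φ) (t • x) x h = t • (θ (t • x) x * fderiv ℝ Φ (t • x) h) +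
      (t • fderiv ℝ θ (t • x) h x + θ (t • x) h) * Φ (t • x) - fderiv ℝ Φ (t • x) h := by
      rw [← f1]; abel
    have g2 : t • fderiv ℝ θ (t • x) h x = t • fderiv ℝ θ (t • x) x h
      + t • (θ (t • x) h * θ (t • x) x) - t • (θ (t • x) x * θ (t • x) h) := by
      rw [← sub_eq_zero, ← f2]; abel
    have g3 : t • (θ (t • x) h * fderiv ℝ Φ (t • x) x) =
        t • (θ (t • x) h * θ (t • x) x * Φ (t • x)) := by
      rw [← mul_smul_comm, f3, mul_smul_comm, mul_assoc]
    rw [smul_sub, smul_add, g3, g1, g2]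
    simp only [e, smul_mul_assoc, mul_smul_comm, add_mul, sub_mul, mul_sub, mul_assoc, smul_sub]
    abel
  have hcontθ : ContinuousOn (fun t : ℝ ↦ ‖θ (t • x) x‖) (Icc 0 1) :=
    (((hθ.continuous.comp (by fun_prop : Continuous fun t : ℝ ↦ t • x)).clm_apply
      continuous_const).norm).continuousOn
  obtain ⟨C, hC⟩ := isCompact_Icc.bddAbove_image hcontθ
  have hz := eq_zero_of_abs_deriv_le_mul_abs_self_of_eq_zero_right (f := e) (K := C) (a := 0)
    (b := 1) (fun t ht ↦ (hder t ht).continuousAt.continuousWithinAt)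
    (fun t ht ↦ (hder t (Ico_subset_Icc_self ht)).hasDerivWithinAt) (by simp [e])
    (fun t ht ↦ (norm_mul_le _ _).trans (by
      gcongr
      exact hC (mem_image_of_mem _ (Ico_subset_Icc_self ht)))) 1 (by simp)
  simp only [e, one_smul] at hz
  exact sub_eq_zero.1 hz

end FlatSystem

end HorizontalForms

namespace HorizontalForms

open Filter Topology

section FlatSystem

universe u v

/-- A flat linear system has a smooth invertible solution near every point. -/
theorem exists_local_solution {E : Type u} [NormedAddCommGroup E] [NormedSpace ℝ E]
    [HasContDiffBump E] {A : Type (max u v)} [NormedRing A] [NormedAlgebra ℝ A] [CompleteSpace A]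
    {U : Set E} (hU : IsOpen U) (θ : E → E →L[ℝ] A) (hθ : ContDiffOn ℝ ∞ θ U)
    (hflat : ∀ x ∈ U, ∀ v w, fderiv ℝ θ x v w - fderiv ℝ θ x w v +
      θ x w * θ x v - θ x v * θ x w = 0) (ξ : E) (hξ : ξ ∈ U) :
    ∃ V ⊆ U, IsOpen V ∧ ξ ∈ V ∧ ∃ Φ : E → A, ContDiffOn ℝ ∞ Φ V ∧ (∀ x ∈ V, IsUnit (Φ x)) ∧
      ∀ x ∈ V, ∀ h, fderiv ℝ Φ x h = θ x h * Φ x := by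
  obtain ⟨R, hR, hRU⟩ := Metric.isOpen_iff.1 hU ξ hξ
  -- The cutoff makes the coefficients smooth on all of `E`, as the radial construction requires.
  -- They are unchanged, hence still flat, on the ball of radius `R / 4`.
  let f : ContDiffBump (0 : E) := ⟨R / 4, R / 2, by positivity, by linarith⟩
  let θ' : E → E →L[ℝ] A := fun x ↦ f x • θ (x + ξ)
  have hmem : ∀ x ∈ Metric.ball (0 : E) R, x + ξ ∈ U := fun x hx ↦ hRU (by
    simpa [dist_eq_norm] using hx)
  have hθ' : ContDiff ℝ ∞ θ' := by
    rw [contDiff_iff_contDiffAt]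
    intro x
    by_cases hx : x ∈ Metric.ball (0 : E) R
    · refine f.contDiff.contDiffAt.smul ?_
      exact ((hθ _ (hmem x hx)).contDiffAt (hU.mem_nhds (hmem x hx))).comp x
        (contDiffAt_id.add contDiffAt_const)
    · have hx' : x ∉ tsupport f := by
        rw [f.tsupport_eq]
        simp only [mem_closedBall_zero_iff, mem_ball_zero_iff, not_lt, not_le, f] at hx ⊢
        linarith
      refine (contDiffAt_const (c := (0 : E →L[ℝ] A))).congr_of_eventuallyEq ?_
      filter_upwards [notMem_tsupport_iff_eventuallyEq.1 hx'] with y hy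
      change f y • θ (y + ξ) = 0
      rw [hy]
      exact zero_smul ℝ (θ (y + ξ))
  have heq : ∀ x ∈ Metric.ball (0 : E) (R / 4), θ' =ᶠ[𝓝 x] fun x ↦ θ (x + ξ) := by
    intro x hx
    filter_upwards [Metric.isOpen_ball.mem_nhds hx] with y hy
    have : f y = 1 := f.one_of_mem_closedBall (Metric.ball_subset_closedBall hy)
    simp [θ', this]
  have hsub : Metric.ball (0 : E) (R / 4) ⊆ Metric.ball 0 R :=
    Metric.ball_subset_ball (by linarith)
  have hflat' : ∀ x ∈ Metric.ball (0 : E) (R / 4), ∀ v w, fderiv ℝ θ' x v w - fderiv ℝ θ' x w v +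
      θ' x w * θ' x v - θ' x v * θ' x w = 0 := by
    intro x hx v w
    rw [(heq x hx).fderiv_eq, (heq x hx).eq_of_nhds, fderiv_comp_add_right]
    exact hflat _ (hmem x (hsub hx)) v w
  obtain ⟨r, hr, Φ, hΦ, hΦ1, hrad⟩ := exists_radial_solution.{u, v} θ' hθ'
  set s := min r (R / 4) with hs
  have hs0 : 0 < s := lt_min hr (by positivity)
  have hsr : Metric.ball (0 : E) s ⊆ Metric.ball 0 r := Metric.ball_subset_ball (min_le_left _ _)
  have hsR : Metric.ball (0 : E) s ⊆ Metric.ball 0 (R / 4) :=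
    Metric.ball_subset_ball (min_le_right _ _)
  have hsol := fderiv_eq_of_radial θ' hθ' (fun x hx ↦ hflat' x (hsR hx)) Φ (hΦ.mono hsr)
    (fun x hx ↦ hrad x (hsr hx))
  -- Since `Φ 0 = 1`, this open set of points where `Φ` is invertible contains the centre.
  have hopen : IsOpen (Metric.ball (0 : E) s ∩ Φ ⁻¹' {a | IsUnit a}) :=
    (hΦ.mono hsr).continuousOn.isOpen_inter_preimage Metric.isOpen_ball Units.isOpen
  refine ⟨(fun x ↦ x - ξ) ⁻¹' (Metric.ball (0 : E) s ∩ Φ ⁻¹' {a | IsUnit a}), fun x hx ↦ ?_,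
    hopen.preimage (by fun_prop), ?_, fun x ↦ Φ (x - ξ), ?_, fun x hx ↦ hx.2, fun x hx h ↦ ?_⟩
  · simpa using hmem _ (hsub (hsR hx.1))
  · simp [hΦ1, hs0]
  · exact (hΦ.mono (inter_subset_left.trans hsr)).comp (contDiff_id.sub contDiff_const).contDiffOn
      (fun x hx ↦ hx)
  · rw [fderiv_comp_sub, hsol _ hx.1, (heq _ (hsR hx.1)).eq_of_nhds, sub_add_cancel]

/-- Two solutions of a linear system differ by a locally constant factor. -/
lemma eventually_inverse_mul_eq {E : Type*} [NormedAddCommGroup E] [NormedSpace ℝ E]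
    {A : Type*} [NormedRing A] [NormedAlgebra ℝ A] [CompleteSpace A] {V : Set E} (hV : IsOpen V)
    (θ : E → E →L[ℝ] A) (Φ Ψ : E → A) (hΦ : ∀ x ∈ V, DifferentiableAt ℝ Φ x)
    (hΨ : ∀ x ∈ V, DifferentiableAt ℝ Ψ x)
    (hΦu : ∀ x ∈ V, IsUnit (Φ x)) (hΦs : ∀ x ∈ V, ∀ h, fderiv ℝ Φ x h = θ x h * Φ x)
    (hΨs : ∀ x ∈ V, ∀ h, fderiv ℝ Ψ x h = θ x h * Ψ x) (y : E) (hy : y ∈ V) :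
    ∀ᶠ z in 𝓝 y, Ring.inverse (Φ z) * Ψ z = Ring.inverse (Φ y) * Ψ y := by
  let q : E → A := fun z ↦ Ring.inverse (Φ z) * Ψ z
  have hq : ∀ x ∈ V, HasFDerivAt q (0 : E →L[ℝ] A) x := by
    intro x hx
    have hinv : DifferentiableAt ℝ (fun z ↦ Ring.inverse (Φ z)) x := by
      obtain ⟨u, hu⟩ := hΦu x hx
      have : DifferentiableAt ℝ Ring.inverse (Φ x) := by
        rw [← hu]; exact differentiableAt_inverse (𝕜 := ℝ) u.isUnit
      exact this.comp x (hΦ x hx)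
    have hqd : HasFDerivAt q (fderiv ℝ q x) x := (hinv.mul (hΨ x hx)).hasFDerivAt
    -- Differentiating `Φ q = Ψ` and inserting both equations leaves `Φ dq = 0`, with `Φ`
    -- invertible.
    have e1 : (fun z ↦ Φ z * q z) =ᶠ[𝓝 x] Ψ := by
      filter_upwards [hV.mem_nhds hx] with z hz
      simp only [q]
      rw [← mul_assoc, Ring.mul_inverse_cancel _ (hΦu z hz), one_mul]
    have e2 := ((hΦ x hx).hasFDerivAt.mul' hqd).unique
      ((hΨ x hx).hasFDerivAt.congr_of_eventuallyEq e1)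
    suffices fderiv ℝ q x = 0 by rwa [this] at hqd
    ext h
    have e3 := congrArg (fun T : E →L[ℝ] A ↦ T h) e2
    simp only [_root_.add_apply, _root_.smul_apply, smul_eq_mul, MulOpposite.smul_eq_mul_unop,
      MulOpposite.unop_op, hΦs x hx, hΨs x hx] at e3
    rw [mul_assoc, e1.eq_of_nhds, add_eq_right] at e3
    simpa using (hΦu x hx).mul_right_eq_zero.1 e3
  obtain ⟨r, hr, hrV⟩ := Metric.isOpen_iff.1 hV y hy
  filter_upwards [Metric.ball_mem_nhds y hr] with z hz
  exact (convex_ball y r).is_const_of_fderivWithin_eq_zero (𝕜 := ℝ) (f := q)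
    (fun x hx ↦ (hq x (hrV hx)).differentiableAt.differentiableWithinAt)
    (fun x hx ↦ by
      rw [fderivWithin_of_isOpen Metric.isOpen_ball hx, (hq x (hrV hx)).fderiv])
    hz (Metric.mem_ball_self hr)

end FlatSystem

/-! ### Symmetry of mixed partial derivatives -/

/-- The derivative with respect to `t` of the differential of `G (t, ·)` is the differential of
the derivative with respect to `t`. -/
lemma hasDerivAt_fderiv_of_contDiffAt {E Z : Type*} [NormedAddCommGroup E] [NormedSpace ℝ E]
    [NormedAddCommGroup Z] [NormedSpace ℝ Z] {G : ℝ × E → Z} {t : ℝ} {ξ : E}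
    (hG : ContDiffAt ℝ ∞ G (t, ξ)) :
    HasDerivAt (fun s ↦ fderiv ℝ (fun y ↦ G (s, y)) ξ)
      (fderiv ℝ (fun y ↦ deriv (fun s ↦ G (s, y)) t) ξ) t := by
  have h2 : ContDiffAt ℝ 2 G (t, ξ) := hG.of_le (WithTop.coe_le_coe.2 (OrderTop.le_top (2 : ℕ∞)))
  have hd : ∀ᶠ p in 𝓝 (t, ξ), HasFDerivAt G (fderiv ℝ G p) p := by
    filter_upwards [(h2.eventually (by simp))] with p hp
    exact (hp.differentiableAt (by simp)).hasFDerivAt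
  have hdd : HasFDerivAt (fderiv ℝ G) (fderiv ℝ (fderiv ℝ G) (t, ξ)) (t, ξ) :=
    ((hG.fderiv_right (m := ∞) (by simp)).differentiableAt (by simp)).hasFDerivAt
  have hsymm := h2.isSymmSndFDerivAt (by simp)
  have hl : HasDerivAt (fun s : ℝ ↦ (s, ξ)) ((1 : ℝ), (0 : E)) t :=
    (hasDerivAt_id t).prodMk (hasDerivAt_const t ξ)
  have hr : HasFDerivAt (fun y : E ↦ (t, y)) (ContinuousLinearMap.inr ℝ ℝ E) ξ :=
    hasFDerivAt_prodMk_right t ξ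
  have e1 : (fun s ↦ fderiv ℝ (fun y ↦ G (s, y)) ξ) =ᶠ[𝓝 t]
      fun s ↦ (fderiv ℝ G (s, ξ)).comp (ContinuousLinearMap.inr ℝ ℝ E) := by
    filter_upwards [hl.continuousAt.eventually hd] with s hs
    exact (hs.comp ξ (hasFDerivAt_prodMk_right s ξ)).fderiv
  have e2 : (fun y ↦ deriv (fun s ↦ G (s, y)) t) =ᶠ[𝓝 ξ]
      fun y ↦ fderiv ℝ G (t, y) ((1 : ℝ), (0 : E)) := by
    filter_upwards [hr.continuousAt.eventually hd] with y hy
    exact (hy.comp_hasDerivAt t ((hasDerivAt_id t).prodMk (hasDerivAt_const t y))).deriv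
  -- Both iterated derivatives are entries of the second derivative of `G` at `(t, ξ)`, on the pairs
  -- `((1, 0), (0, v))` and `((0, v), (1, 0))`.
  have d1 : HasDerivAt (fun s ↦ (fderiv ℝ G (s, ξ)).comp (ContinuousLinearMap.inr ℝ ℝ E))
      ((fderiv ℝ (fderiv ℝ G) (t, ξ) (1, 0)).comp (ContinuousLinearMap.inr ℝ ℝ E)) t :=
    (((ContinuousLinearMap.compL ℝ E (ℝ × E) Z).flip
      (ContinuousLinearMap.inr ℝ ℝ E)).hasFDerivAt).comp_hasDerivAt t (hdd.comp_hasDerivAt t hl)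
  have d2 : HasFDerivAt (fun y ↦ fderiv ℝ G (t, y) ((1 : ℝ), (0 : E)))
      (((ContinuousLinearMap.apply ℝ Z ((1 : ℝ), (0 : E))).comp
        (fderiv ℝ (fderiv ℝ G) (t, ξ))).comp (ContinuousLinearMap.inr ℝ ℝ E)) ξ :=
    (((ContinuousLinearMap.apply ℝ Z ((1 : ℝ), (0 : E))).hasFDerivAt).comp (t, ξ) hdd).comp ξ hr
  rw [e2.fderiv_eq, d2.fderiv]
  convert! d1.congr_of_eventuallyEq e1 using 1
  ext v
  exact (hsymm (1, 0) (0, v)).symm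

end HorizontalForms

namespace HorizontalForms

open Filter Topology

/-! ### Locally constant cocycles on simply connected spaces -/

/-- The fibre bundle with discrete fibre attached to the locally constant cocycle
`(τ j x)⁻¹ * τ i x`. -/
def locallyConstantCore {X F : Type*} [TopologicalSpace X] [TopologicalSpace F]
    [DiscreteTopology F] (U : X → Set X) (hU : ∀ i, IsOpen (U i)) (hmem : ∀ i, i ∈ U i)
    (τ : X → X → Equiv.Perm F)
    (hτ : ∀ i j, ∀ y ∈ U i ∩ U j, ∀ᶠ z in 𝓝 y, (τ j z)⁻¹ * τ i z = (τ j y)⁻¹ * τ i y) :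
    FiberBundleCore X X F where
  baseSet := U
  isOpen_baseSet := hU
  indexAt := id
  mem_baseSet_at := hmem
  coordChange i j x := ((τ j x)⁻¹ * τ i x : Equiv.Perm F)
  coordChange_self i x _ v := by simp
  continuousOn_coordChange i j := by
    rintro ⟨y, v⟩ hy
    refine ContinuousAt.continuousWithinAt ?_
    have h0 : ContinuousAt (fun _ : X × F ↦ ((τ j y)⁻¹ * τ i y) v) (y, v) := continuousAt_const
    have h1 : ∀ᶠ p : X × F in 𝓝 (y, v), p.2 = v := by
      rw [nhds_prod_eq]
      exact (tendsto_snd (f := 𝓝 y) (g := 𝓝 v)).eventually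
        (p := fun w ↦ w = v) (by simp)
    have h2 : ∀ᶠ p : X × F in 𝓝 (y, v), (τ j p.1)⁻¹ * τ i p.1 = (τ j y)⁻¹ * τ i y :=
      (continuous_fst.tendsto (y, v)).eventually (hτ i j y hy.1)
    have h3 : (fun _ : X × F ↦ ((τ j y)⁻¹ * τ i y) v) =ᶠ[𝓝 (y, v)]
        fun p ↦ ((τ j p.1)⁻¹ * τ i p.1) p.2 := by
      filter_upwards [h1, h2] with p hp1 hp2
      rw [hp1, hp2]
    exact h0.congr h3
  coordChange_comp i j k x _ v := by simp

/-- A locally constant cocycle on a simply connected space is trivial. -/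
theorem exists_section_of_locallyConstant {X F : Type*} [TopologicalSpace X]
    [SimplyConnectedSpace X] [LocallyPathConnectedSpace X]
    (U : X → Set X) (hU : ∀ i, IsOpen (U i)) (hmem : ∀ i, i ∈ U i)
    (τ : X → X → Equiv.Perm F)
    (hτ : ∀ i j, ∀ y ∈ U i ∩ U j, ∀ᶠ z in 𝓝 y, (τ j z)⁻¹ * τ i z = (τ j y)⁻¹ * τ i y)
    (x₀ : X) (v : F) :
    ∃ f : X → F, f x₀ = v ∧
      ∀ i, ∀ y ∈ U i, ∀ᶠ z in 𝓝 y, (τ i z)⁻¹ (f z) = (τ i y)⁻¹ (f y) := by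
  -- With a discrete fibre the bundle is a covering of `X`, and simple connectedness lifts the
  -- identity map to a section.
  let : TopologicalSpace F := ⊥
  have : DiscreteTopology F := ⟨rfl⟩
  let Z := locallyConstantCore U hU hmem τ hτ
  have hcov : IsCoveringMap Z.proj := FiberBundle.isCoveringMap (F := F) (E := Z.Fiber)
  obtain ⟨s, ⟨hs0, hs⟩, -⟩ := hcov.existsUnique_continuousMap_lifts (ContinuousMap.id X) x₀
    (⟨x₀, (τ x₀ x₀)⁻¹ v⟩ : Z.TotalSpace) rfl
  have hproj : ∀ y, (s y).1 = y := fun y ↦ congrFun hs y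
  let val : Z.TotalSpace → F := fun p ↦ p.2
  -- The fibre coordinate of `s y` refers to the index `y` itself, and `τ` turns it into an actual
  -- value. In the trivialization `i` the coordinate is `(τ i y)⁻¹ (f y)`, which is continuous into
  -- a discrete space.
  refine ⟨fun y ↦ τ (s y).1 y (val (s y)), ?_, fun i y hy ↦ ?_⟩
  · change τ (s x₀).1 x₀ (val (s x₀)) = v
    rw [hs0]; exact (τ x₀ x₀).apply_symm_apply v
  · have h1 : ContinuousAt (fun z ↦ (Z.localTriv i (s z)).2) y := by
      refine continuous_snd.continuousAt.comp (ContinuousAt.comp ?_ s.continuous.continuousAt)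
      refine (Z.localTriv i).continuousOn.continuousAt
        ((Z.localTriv i).open_source.mem_nhds ?_)
      rw [FiberBundleCore.mem_localTriv_source, hproj]
      exact hy
    have h2 := h1.eventually_mem ((isOpen_discrete {(Z.localTriv i (s y)).2}).mem_nhds rfl)
    have key : ∀ z, (Z.localTriv i (s z)).2 = (τ i z)⁻¹ (τ (s z).1 z (val (s z))) := fun z ↦ by
      rw [FiberBundleCore.localTriv_apply]
      change ((τ i (s z).1)⁻¹ * τ (s z).1 (s z).1) (val (s z)) = _
      conv_lhs => enter [1]; rw [hproj]
      rw [hproj]; rfl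
    filter_upwards [h2] with z hz
    rw [← key, ← key]; exact hz

end HorizontalForms

namespace HorizontalForms

open Filter Topology

/-! ### One-forms and vector fields in charts -/

section Charts

variable {m : ℕ} {M : Type*} [TopologicalSpace M] [ChartedSpace (EuclideanSpace ℝ (Fin m)) M]

/-- The inverse of the chart at `x₀`. -/
noncomputable def chartInv (x₀ : M) : EuclideanSpace ℝ (Fin m) → M := (extChartAt (𝓡 m) x₀).symm

/-- The image of the chart at `x₀`. -/
def chartDom (x₀ : M) : Set (EuclideanSpace ℝ (Fin m)) := (extChartAt (𝓡 m) x₀).target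

/-- The differential of the inverse of the chart at `x₀`. -/
noncomputable def chartInvDeriv (x₀ : M) (ξ : EuclideanSpace ℝ (Fin m)) :
    EuclideanSpace ℝ (Fin m) →L[ℝ] TangentSpace (𝓡 m) (chartInv x₀ ξ) :=
  mfderiv 𝓘(ℝ, EuclideanSpace ℝ (Fin m)) (𝓡 m) (chartInv x₀) ξ

lemma isOpen_chartDom (x₀ : M) : IsOpen (chartDom (m := m) x₀) := isOpen_extChartAt_target x₀

lemma chartInv_mem (x₀ : M) {ξ : EuclideanSpace ℝ (Fin m)} (hξ : ξ ∈ chartDom x₀) :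
    chartInv x₀ ξ ∈ (chartAt (EuclideanSpace ℝ (Fin m)) x₀).source := by
  rw [← extChartAt_source (𝓡 m)]
  exact (extChartAt (𝓡 m) x₀).map_target hξ

lemma chart_mem_chartDom (x₀ : M) {x : M}
    (hx : x ∈ (chartAt (EuclideanSpace ℝ (Fin m)) x₀).source) :
    extChartAt (𝓡 m) x₀ x ∈ chartDom (m := m) x₀ := by
  rw [← extChartAt_source (𝓡 m)] at hx
  exact (extChartAt (𝓡 m) x₀).map_source hx

lemma chartInv_chart (x₀ : M) {x : M}
    (hx : x ∈ (chartAt (EuclideanSpace ℝ (Fin m)) x₀).source) :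
    chartInv x₀ (extChartAt (𝓡 m) x₀ x) = x := by
  rw [← extChartAt_source (𝓡 m)] at hx
  exact (extChartAt (𝓡 m) x₀).left_inv hx

lemma chart_chartInv (x₀ : M) {ξ : EuclideanSpace ℝ (Fin m)} (hξ : ξ ∈ chartDom x₀) :
    extChartAt (𝓡 m) x₀ (chartInv x₀ ξ) = ξ :=
  (extChartAt (𝓡 m) x₀).right_inv hξ

variable [IsManifold (𝓡 m) ∞ M]

lemma contMDiffOn_chartInv (x₀ : M) :
    ContMDiffOn 𝓘(ℝ, EuclideanSpace ℝ (Fin m)) (𝓡 m) ∞ (chartInv x₀)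
      (chartDom (m := m) x₀) :=
  contMDiffOn_extChartAt_symm x₀

lemma contMDiffAt_chartInv (x₀ : M) {ξ : EuclideanSpace ℝ (Fin m)} (hξ : ξ ∈ chartDom x₀) :
    ContMDiffAt 𝓘(ℝ, EuclideanSpace ℝ (Fin m)) (𝓡 m) ∞ (chartInv x₀) ξ :=
  (contMDiffOn_chartInv x₀).contMDiffAt ((isOpen_chartDom x₀).mem_nhds hξ)

lemma mdifferentiableAt_chartInv (x₀ : M) {ξ : EuclideanSpace ℝ (Fin m)} (hξ : ξ ∈ chartDom x₀) :
    MDifferentiableAt 𝓘(ℝ, EuclideanSpace ℝ (Fin m)) (𝓡 m) (chartInv x₀) ξ :=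
  (contMDiffAt_chartInv x₀ hξ).mdifferentiableAt (by simp)

instance : IsManifold (𝓡 m) 1 M := .of_le (n := ∞) (by exact_mod_cast le_top)

lemma isInvertible_chartInvDeriv (x₀ : M) {ξ : EuclideanSpace ℝ (Fin m)} (hξ : ξ ∈ chartDom x₀) :
    (chartInvDeriv x₀ ξ).IsInvertible := by
  have := isInvertible_mfderivWithin_extChartAt_symm (I := 𝓡 m) hξ
  rw [ModelWithCorners.Boundaryless.range_eq_univ, mfderivWithin_univ] at this
  exact this

variable {𝔤 : Type*} [NormedLieRing 𝔤] [NormedLieAlgebra 𝔤]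

/-- The expression of a one-form in the chart at `x₀`. -/
noncomputable def chartForm (x₀ : M) (α : RoughOneForm m M 𝔤) (ξ : EuclideanSpace ℝ (Fin m)) :
    EuclideanSpace ℝ (Fin m) →L[ℝ] 𝔤 :=
  (α (chartInv x₀ ξ)).comp (chartInvDeriv x₀ ξ)

lemma contDiffOn_prod_iff {F : Type*} [NormedAddCommGroup F] [NormedSpace ℝ F]
    (s : Set ℝ) (x₀ : M) (G : ℝ × M → F) :
    ContMDiffOn (𝓘(ℝ, ℝ).prod (𝓡 m)) 𝓘(ℝ, F) ∞ G
      (s ×ˢ (chartAt (EuclideanSpace ℝ (Fin m)) x₀).source) ↔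
    ContDiffOn ℝ ∞ (fun p : ℝ × EuclideanSpace ℝ (Fin m) ↦ G (p.1, chartInv x₀ p.2))
      (s ×ˢ chartDom x₀) := by
  rw [← contMDiffOn_iff_contDiffOn]
  constructor
  · intro h
    exact h.comp (contDiff_fst.contMDiff.contMDiffOn.prodMk
      ((contMDiffOn_chartInv x₀).comp contDiff_snd.contMDiff.contMDiffOn fun p hp ↦ hp.2))
      fun p hp ↦ ⟨hp.1, chartInv_mem x₀ hp.2⟩
  · intro h
    have h1 : ContMDiffOn (𝓘(ℝ, ℝ).prod (𝓡 m)) 𝓘(ℝ, ℝ × EuclideanSpace ℝ (Fin m)) ∞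
        (fun p : ℝ × M ↦ (p.1, extChartAt (𝓡 m) x₀ p.2))
        (s ×ˢ (chartAt (EuclideanSpace ℝ (Fin m)) x₀).source) :=
      contMDiffOn_fst.prodMk_space ((contMDiffOn_extChartAt (x := x₀)).comp
        contMDiffOn_snd fun p hp ↦ hp.2)
    refine (h.comp h1 fun p hp ↦ ⟨hp.1, chart_mem_chartDom x₀ hp.2⟩).congr fun p hp ↦ ?_
    simp only [Function.comp_apply]
    rw [chartInv_chart x₀ hp.2]

/-- The trivialization of the cotangent-type bundle at `x₀` is composition with the differential of
the inverse chart, so the bundle coordinate of `β` is exactly its chart expression. -/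
theorem isSmoothCurveOfForms_iff (ε : ℝ) (β : ℝ → RoughOneForm m M 𝔤) :
    IsSmoothCurveOfForms ε β ↔ ∀ x₀ : M,
      ContDiffOn ℝ ∞ (fun p : ℝ × EuclideanSpace ℝ (Fin m) ↦ chartForm x₀ (β p.1) p.2)
        (Ioo (-ε) ε ×ˢ chartDom x₀) := by
  have key : ∀ x₀ : M, ContMDiffOn (𝓘(ℝ, ℝ).prod (𝓡 m))
      ((𝓡 m).prod 𝓘(ℝ, EuclideanSpace ℝ (Fin m) →L[ℝ] 𝔤)) ∞
      (fun p : ℝ × M ↦ (⟨p.2, β p.1 p.2⟩ : TotalSpace (EuclideanSpace ℝ (Fin m) →L[ℝ] 𝔤)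
        (fun x : M ↦ TangentSpace (𝓡 m) x →L[ℝ] Trivial M 𝔤 x)))
      (Ioo (-ε) ε ×ˢ (chartAt (EuclideanSpace ℝ (Fin m)) x₀).source) ↔
      ContDiffOn ℝ ∞ (fun p : ℝ × EuclideanSpace ℝ (Fin m) ↦ chartForm x₀ (β p.1) p.2)
        (Ioo (-ε) ε ×ˢ chartDom x₀) := by
    intro x₀
    rw [Bundle.Trivialization.contMDiffOn_iff (e := trivializationAt
      (EuclideanSpace ℝ (Fin m) →L[ℝ] 𝔤)
      (fun x : M ↦ TangentSpace (𝓡 m) x →L[ℝ] Trivial M 𝔤 x) x₀), and_iff_right contMDiffOn_snd,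
      contDiffOn_prod_iff]
    · refine contDiffOn_congr fun p hp ↦ ?_
      rw [hom_trivializationAt_apply]
      have h1 := TangentBundle.symmL_trivializationAt (I := 𝓡 m) (chartInv_mem x₀ hp.2)
      rw [ModelWithCorners.Boundaryless.range_eq_univ, mfderivWithin_univ,
        chart_chartInv x₀ hp.2] at h1
      simp only [ContinuousLinearMap.inCoordinates]
      rw [h1]
      ext v
      have h2 : (trivializationAt 𝔤 (Trivial M 𝔤) x₀).continuousLinearMapAt ℝ (chartInv x₀ p.2) =
        ContinuousLinearMap.id ℝ 𝔤 := by
        ext w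
        change (trivializationAt 𝔤 (Trivial M 𝔤) x₀).linearMapAt ℝ _ w = w
        exact DFunLike.congr_fun (Trivial.linearMapAt_trivialization (B := M) ℝ 𝔤 _) w
      exact DFunLike.congr_fun h2 _
    · rintro p ⟨-, hp⟩
      rw [hom_trivializationAt_source]
      exact ⟨hp, mem_univ _⟩
  constructor
  · intro h x₀
    exact (key x₀).1 (ContMDiffOn.mono h (prod_mono_right (subset_univ _)))
  · rintro h ⟨t, x⟩ ⟨ht, -⟩
    have h1 := (key x).2 (h x) (t, x) ⟨ht, mem_chart_source _ x⟩
    refine h1.mono_of_mem_nhdsWithin ?_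
    rw [nhdsWithin_prod_eq, nhdsWithin_univ]
    exact prod_mem_prod self_mem_nhdsWithin
      ((chartAt _ x).open_source.mem_nhds (mem_chart_source _ x))

lemma isSmoothOneForm_iff_const (α : RoughOneForm m M 𝔤) :
    IsSmoothOneForm α ↔ IsSmoothCurveOfForms 1 (fun _ ↦ α) := by
  constructor
  · intro h
    exact (h.comp contMDiff_snd).contMDiffOn
  · intro h
    rw [IsSmoothOneForm, ← contMDiffOn_univ]
    exact ContMDiffOn.comp h (contMDiffOn_const (c := (0 : ℝ)).prodMk contMDiffOn_id)
      fun x _ ↦ ⟨by simp, mem_univ _⟩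

theorem isSmoothOneForm_iff (α : RoughOneForm m M 𝔤) :
    IsSmoothOneForm α ↔ ∀ x₀ : M, ContDiffOn ℝ ∞ (chartForm x₀ α) (chartDom x₀) := by
  rw [isSmoothOneForm_iff_const, isSmoothCurveOfForms_iff]
  refine forall_congr' fun x₀ ↦ ⟨fun h ↦ ?_, fun h ↦ ?_⟩
  · exact h.comp (contDiff_const (c := (0 : ℝ)).prodMk contDiff_id).contDiffOn
      fun x hx ↦ ⟨by simp, hx⟩
  · exact h.comp contDiff_snd.contDiffOn fun p hp ↦ hp.2

end Charts

end HorizontalForms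

namespace HorizontalForms

open Filter Topology

/-! ### Vector fields, exterior derivative and the Maurer-Cartan equation in charts -/

section Charts

variable {m : ℕ} {M : Type*} [TopologicalSpace M] [ChartedSpace (EuclideanSpace ℝ (Fin m)) M]
  [IsManifold (𝓡 m) ∞ M]

/-- The expression of a vector field in the chart at `x₀`. -/
noncomputable def chartField (x₀ : M) (X : ∀ x : M, TangentSpace (𝓡 m) x)
    (ξ : EuclideanSpace ℝ (Fin m)) : EuclideanSpace ℝ (Fin m) :=
  VectorField.mpullback 𝓘(ℝ, EuclideanSpace ℝ (Fin m)) (𝓡 m) (chartInv x₀) X ξ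

lemma chartInvDeriv_chartField (x₀ : M) (X : ∀ x : M, TangentSpace (𝓡 m) x)
    {ξ : EuclideanSpace ℝ (Fin m)} (hξ : ξ ∈ chartDom x₀) :
    chartInvDeriv x₀ ξ (chartField x₀ X ξ) = X (chartInv x₀ ξ) :=
  DFunLike.congr_fun (isInvertible_chartInvDeriv x₀ hξ).self_comp_inverse (X (chartInv x₀ ξ))

lemma chartField_unique (x₀ : M) (X : ∀ x : M, TangentSpace (𝓡 m) x)
    {ξ : EuclideanSpace ℝ (Fin m)} (hξ : ξ ∈ chartDom x₀) (v : EuclideanSpace ℝ (Fin m))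
    (h : X (chartInv x₀ ξ) = chartInvDeriv x₀ ξ v) : chartField x₀ X ξ = v := by
  apply (isInvertible_chartInvDeriv x₀ hξ).injective
  rw [chartInvDeriv_chartField x₀ X hξ, h]

lemma contDiffAt_chartField (x₀ : M) (X : ∀ x : M, TangentSpace (𝓡 m) x) (hX : IsSmoothField X)
    {ξ : EuclideanSpace ℝ (Fin m)} (hξ : ξ ∈ chartDom x₀) :
    ContDiffAt ℝ ∞ (chartField x₀ X) ξ := by
  refine contMDiffAt_vectorSpace_iff_contDiffAt.1 ?_
  exact ContMDiffAt.mpullback_vectorField_preimage (n := ∞) (hX _) (contMDiffAt_chartInv x₀ hξ)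
    (isInvertible_chartInvDeriv x₀ hξ) (by simp)

variable {𝔤 : Type*} [NormedLieRing 𝔤] [NormedLieAlgebra 𝔤]

lemma chartForm_chartField (x₀ : M) (α : RoughOneForm m M 𝔤) (X : ∀ x : M, TangentSpace (𝓡 m) x)
    {ξ : EuclideanSpace ℝ (Fin m)} (hξ : ξ ∈ chartDom x₀) :
    chartForm x₀ α ξ (chartField x₀ X ξ) = α (chartInv x₀ ξ) (X (chartInv x₀ ξ)) :=
  congrArg (α (chartInv x₀ ξ)) (chartInvDeriv_chartField x₀ X hξ)

lemma contMDiffAt_iff_contDiffAt_chart {F : Type*} [NormedAddCommGroup F] [NormedSpace ℝ F]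
    (x₀ : M) (f : M → F) {ξ : EuclideanSpace ℝ (Fin m)} (hξ : ξ ∈ chartDom x₀) :
    ContMDiffAt (𝓡 m) 𝓘(ℝ, F) ∞ f (chartInv x₀ ξ) ↔
      ContDiffAt ℝ ∞ (fun ξ ↦ f (chartInv x₀ ξ)) ξ := by
  rw [← contMDiffAt_iff_contDiffAt]
  constructor
  · intro h
    exact h.comp ξ (contMDiffAt_chartInv x₀ hξ)
  · intro h
    have h1 : ContMDiffAt (𝓡 m) 𝓘(ℝ, EuclideanSpace ℝ (Fin m)) ∞ (extChartAt (𝓡 m) x₀)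
        (chartInv x₀ ξ) := contMDiffAt_extChartAt' (chartInv_mem x₀ hξ)
    refine (ContMDiffAt.comp_of_eq h h1 (chart_chartInv x₀ hξ)).congr_of_eventuallyEq ?_
    filter_upwards [(chartAt _ x₀).open_source.mem_nhds (chartInv_mem x₀ hξ)] with z hz
    simp only [Function.comp_apply]
    rw [chartInv_chart x₀ hz]

lemma mdifferentiableAt_of_chart {F : Type*} [NormedAddCommGroup F] [NormedSpace ℝ F]
    (x₀ : M) (f : M → F) {ξ : EuclideanSpace ℝ (Fin m)} (hξ : ξ ∈ chartDom x₀)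
    (h : DifferentiableAt ℝ (fun ξ ↦ f (chartInv x₀ ξ)) ξ) :
    MDifferentiableAt (𝓡 m) 𝓘(ℝ, F) f (chartInv x₀ ξ) := by
  have h1 : MDifferentiableAt (𝓡 m) 𝓘(ℝ, EuclideanSpace ℝ (Fin m)) (extChartAt (𝓡 m) x₀)
      (chartInv x₀ ξ) := (contMDiffAt_extChartAt' (n := ∞) (chartInv_mem x₀ hξ)).mdifferentiableAt
        (by simp)
  refine (MDifferentiableAt.comp_of_eq (f := extChartAt (𝓡 m) x₀) (x := chartInv x₀ ξ)
    h.mdifferentiableAt h1 (chart_chartInv x₀ hξ)).congr_of_eventuallyEq ?_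
  filter_upwards [(chartAt _ x₀).open_source.mem_nhds (chartInv_mem x₀ hξ)] with z hz
  simp only [Function.comp_apply]
  rw [chartInv_chart x₀ hz]

lemma mfderiv_chartInvDeriv {F : Type*} [NormedAddCommGroup F] [NormedSpace ℝ F]
    (x₀ : M) (f : M → F) {ξ : EuclideanSpace ℝ (Fin m)} (hξ : ξ ∈ chartDom x₀)
    (h : DifferentiableAt ℝ (fun ξ ↦ f (chartInv x₀ ξ)) ξ) (v : EuclideanSpace ℝ (Fin m)) :
    mfderiv (𝓡 m) 𝓘(ℝ, F) f (chartInv x₀ ξ) (chartInvDeriv x₀ ξ v) =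
      fderiv ℝ (fun ξ ↦ f (chartInv x₀ ξ)) ξ v := by
  have h1 := mfderiv_comp ξ (mdifferentiableAt_of_chart x₀ f hξ h) (mdifferentiableAt_chartInv x₀ hξ)
  have h2 := DFunLike.congr_fun h1 v
  rw [mfderiv_eq_fderiv] at h2
  exact h2.symm

lemma contMDiff_iff_contDiffOn_chart {F : Type*} [NormedAddCommGroup F] [NormedSpace ℝ F]
    (f : M → F) : ContMDiff (𝓡 m) 𝓘(ℝ, F) ∞ f ↔
      ∀ x₀ : M, ContDiffOn ℝ ∞ (fun ξ ↦ f (chartInv x₀ ξ)) (chartDom (m := m) x₀) := by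
  constructor
  · intro h x₀ ξ hξ
    exact ((contMDiffAt_iff_contDiffAt_chart x₀ f hξ).1 (h _)).contDiffWithinAt
  · intro h x
    have h1 := chart_mem_chartDom x (mem_chart_source (EuclideanSpace ℝ (Fin m)) x)
    have h2 := (contMDiffAt_iff_contDiffAt_chart x f h1).2
      ((h x).contDiffAt ((isOpen_chartDom x).mem_nhds h1))
    rwa [chartInv_chart x (mem_chart_source _ x)] at h2

/-- The exterior derivative of a one-form on a normed space. -/
noncomputable def flatExtDeriv {E F : Type*} [NormedAddCommGroup E] [NormedSpace ℝ E]
    [NormedAddCommGroup F] [NormedSpace ℝ F] (a : E → E →L[ℝ] F) (ξ v w : E) : F :=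
  fderiv ℝ a ξ v w - fderiv ℝ a ξ w v

/-- The Lie bracket is natural under pullback by the inverse chart. In the chart, the terms
containing derivatives of the two fields cancel against the bracket term. -/
lemma extDerivOneForm_chartInv (x₀ : M) (α : RoughOneForm m M 𝔤)
    (X Y : ∀ x : M, TangentSpace (𝓡 m) x) (hX : IsSmoothField X) (hY : IsSmoothField Y)
    {ξ : EuclideanSpace ℝ (Fin m)} (hξ : ξ ∈ chartDom x₀)
    (hα : DifferentiableAt ℝ (chartForm x₀ α) ξ) :
    extDerivOneForm α X Y (chartInv x₀ ξ) =
      flatExtDeriv (chartForm x₀ α) ξ (chartField x₀ X ξ) (chartField x₀ Y ξ) := by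
  have hXd := (contDiffAt_chartField x₀ X hX hξ).differentiableAt (by simp)
  have hYd := (contDiffAt_chartField x₀ Y hY hξ).differentiableAt (by simp)
  have hev : ∀ Z : ∀ x : M, TangentSpace (𝓡 m) x,
      (fun ξ ↦ α (chartInv x₀ ξ) (Z (chartInv x₀ ξ))) =ᶠ[𝓝 ξ]
        fun ξ ↦ chartForm x₀ α ξ (chartField x₀ Z ξ) := fun Z ↦ by
    filter_upwards [(isOpen_chartDom x₀).mem_nhds hξ] with ζ hζ
    exact (chartForm_chartField x₀ α Z hζ).symm
  have hdir : ∀ Y Z : ∀ x : M, TangentSpace (𝓡 m) x, DifferentiableAt ℝ (chartField x₀ Z) ξ →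
      dirDeriv (fun y ↦ α y (Z y)) (chartInv x₀ ξ) (Y (chartInv x₀ ξ)) =
      chartForm x₀ α ξ (fderiv ℝ (chartField x₀ Z) ξ (chartField x₀ Y ξ)) +
        fderiv ℝ (chartForm x₀ α) ξ (chartField x₀ Y ξ) (chartField x₀ Z ξ) := by
    intro Y Z hZ
    have e1 := hα.hasFDerivAt.clm_apply hZ.hasFDerivAt
    have e2 := e1.congr_of_eventuallyEq (hev Z)
    rw [dirDeriv, ← chartInvDeriv_chartField x₀ Y hξ,
      mfderiv_chartInvDeriv x₀ _ hξ e2.differentiableAt, e2.fderiv]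
    rfl
  have hbr : α (chartInv x₀ ξ) (VectorField.mlieBracket (𝓡 m) X Y (chartInv x₀ ξ)) =
      chartForm x₀ α ξ (fderiv ℝ (chartField x₀ Y) ξ (chartField x₀ X ξ) -
        fderiv ℝ (chartField x₀ X) ξ (chartField x₀ Y ξ)) := by
    rw [← chartForm_chartField x₀ α _ hξ]
    congr 1
    have h2 : minSmoothness ℝ 2 ≤ (∞ : WithTop ℕ∞) := by
      simpa using WithTop.coe_le_coe.2 (OrderTop.le_top (2 : ℕ∞))
    have : IsManifold (𝓡 m) (minSmoothness ℝ 2) M := .of_le (n := ∞) h2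
    have h1 := VectorField.mpullback_mlieBracket (I := 𝓘(ℝ, EuclideanSpace ℝ (Fin m)))
      (I' := 𝓡 m) (f := chartInv x₀) (n := ∞) (x₀ := ξ)
      ((hX _).mdifferentiableAt (by simp)) ((hY _).mdifferentiableAt (by simp))
      (contMDiffAt_chartInv x₀ hξ) h2
    refine h1.trans ?_
    rw [← VectorField.mlieBracketWithin_univ, VectorField.mlieBracketWithin_eq_lieBracketWithin]
    exact congrFun (VectorField.lieBracketWithin_univ (𝕜 := ℝ) (V := chartField x₀ X)
      (W := chartField x₀ Y)) ξ
  rw [extDerivOneForm, hdir X Y hYd, hdir Y X hXd, hbr, flatExtDeriv, map_sub]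
  abel

/-- A smooth section over a neighbourhood of `x` agrees near `x` with a multiple of it by a smooth
function that is smooth on the whole of `M`. -/
lemma exists_smoothField_eventuallyEq [T2Space M] (x : M) {U : Set M} (hU : IsOpen U)
    (hx : x ∈ U) (X : ∀ x : M, TangentSpace (𝓡 m) x)
    (hX : ContMDiffOn (𝓡 m) (𝓡 m).tangent ∞
      (fun x ↦ (⟨x, X x⟩ : TangentBundle (𝓡 m) M)) U) :
    ∃ ψ : M → ℝ, (∀ᶠ y in 𝓝 x, ψ y = 1) ∧ (∀ y ∉ U, ψ y = 0) ∧
      IsSmoothField (fun y ↦ ψ y • X y) := by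
  obtain ⟨f, -, hf⟩ := (SmoothBumpFunction.nhds_basis_tsupport (I := 𝓡 m) x).mem_iff.1
    (hU.mem_nhds hx)
  refine ⟨f, f.eventuallyEq_one, fun y hy ↦ image_eq_zero_of_notMem_tsupport fun h ↦ hy (hf h), ?_⟩
  exact ContMDiffOn.smul_section_of_tsupport f.contMDiff.contMDiffOn hU hf hX

lemma exists_smoothField_eq [T2Space M] (x : M) (v : TangentSpace (𝓡 m) x) :
    ∃ X : ∀ x : M, TangentSpace (𝓡 m) x, IsSmoothField X ∧ X x = v := by
  obtain ⟨s, hs, hX⟩ := FiberBundle.exists_contMDiffOn_extend (𝓡 m) (EuclideanSpace ℝ (Fin m))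
    (V := (TangentSpace (𝓡 m) : M → Type _)) (k := ∞) v
  obtain ⟨U, hUs, hU, hxU⟩ := mem_nhds_iff.1 hs
  obtain ⟨ψ, h1, -, h2⟩ := exists_smoothField_eventuallyEq x hU hxU _ (hX.mono hUs)
  refine ⟨_, h2, ?_⟩
  change ψ x • FiberBundle.extend (EuclideanSpace ℝ (Fin m)) v x = v
  rw [h1.self_of_nhds, one_smul, FiberBundle.extend_apply_self]

/-- The Maurer-Cartan equation in charts. -/
theorem mem_maurerCartanForms_iff [T2Space M] (α : RoughOneForm m M 𝔤) :
    α ∈ MaurerCartanForms ↔ IsSmoothOneForm α ∧ ∀ x₀ : M, ∀ ξ ∈ chartDom x₀, ∀ v w,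
      flatExtDeriv (chartForm x₀ α) ξ v w + ⁅chartForm x₀ α ξ v, chartForm x₀ α ξ w⁆ = 0 := by
  refine and_congr_right fun hα ↦ ?_
  have hd : ∀ x₀ : M, ∀ ξ ∈ chartDom x₀, DifferentiableAt ℝ (chartForm x₀ α) ξ :=
    fun x₀ ξ hξ ↦ (((isSmoothOneForm_iff α).1 hα x₀).contDiffAt
      ((isOpen_chartDom x₀).mem_nhds hξ)).differentiableAt (by simp)
  constructor
  · intro h x₀ ξ hξ v w
    -- The equation is stated for global fields; a bump function extends any tangent vector to one.
    obtain ⟨X, hX, hXv⟩ := exists_smoothField_eq (chartInv x₀ ξ) (chartInvDeriv x₀ ξ v)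
    obtain ⟨Y, hY, hYw⟩ := exists_smoothField_eq (chartInv x₀ ξ) (chartInvDeriv x₀ ξ w)
    have h1 := h X Y hX hY (chartInv x₀ ξ)
    rwa [extDerivOneForm_chartInv x₀ α X Y hX hY hξ (hd x₀ ξ hξ),
      ← chartForm_chartField x₀ α _ hξ, ← chartForm_chartField x₀ α _ hξ,
      chartField_unique x₀ X hξ v hXv, chartField_unique x₀ Y hξ w hYw] at h1
  · intro h X Y hX hY x
    have hx := chart_mem_chartDom x (mem_chart_source (EuclideanSpace ℝ (Fin m)) x)
    have h1 := h x _ hx (chartField x X (extChartAt (𝓡 m) x x))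
      (chartField x Y (extChartAt (𝓡 m) x x))
    rwa [← extDerivOneForm_chartInv x α X Y hX hY hx (hd x _ hx), chartForm_chartField x α _ hx,
      chartForm_chartField x α _ hx, chartInv_chart x (mem_chart_source _ x)] at h1

end Charts

end HorizontalForms

namespace HorizontalForms

open Filter Topology

/-! ### Infinitesimal gauge transformations -/

section Bracket

variable {𝔤 : Type*} [NormedLieRing 𝔤] [NormedLieAlgebra 𝔤] [FiniteDimensional ℝ 𝔤]

variable (𝔤) in
/-- The Lie bracket as a continuous bilinear map. -/
noncomputable def bracketL : 𝔤 →L[ℝ] 𝔤 →L[ℝ] 𝔤 :=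
  LinearMap.toContinuousLinearMap
    ((LinearMap.toContinuousLinearMap : (𝔤 →ₗ[ℝ] 𝔤) ≃ₗ[ℝ] (𝔤 →L[ℝ] 𝔤)).toLinearMap ∘ₗ
      LinearMap.mk₂ ℝ (fun a b : 𝔤 ↦ ⁅a, b⁆) add_lie smul_lie lie_add
        (fun c a b ↦ lie_smul c a b))

@[simp] lemma bracketL_apply (a b : 𝔤) : bracketL 𝔤 a b = ⁅a, b⁆ := rfl

/-- The operator `(a, b) ↦ (-[g, a] + b, 0)`. -/
noncomputable def gaugeGen (g : 𝔤) : (𝔤 × 𝔤) →L[ℝ] (𝔤 × 𝔤) :=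
  (ContinuousLinearMap.inl ℝ 𝔤 𝔤).comp
    (ContinuousLinearMap.snd ℝ 𝔤 𝔤 - (bracketL 𝔤 g).comp (ContinuousLinearMap.fst ℝ 𝔤 𝔤))

lemma contDiff_gaugeGen : ContDiff ℝ ∞ (gaugeGen (𝔤 := 𝔤)) :=
  contDiff_const.clm_comp (contDiff_const.sub ((bracketL 𝔤).contDiff.clm_comp contDiff_const))

/-- The solution operator of `u' = -[g, u] + b`, `u(0) = a`. -/
noncomputable def gaugeOp (t : ℝ) (g : 𝔤) : (𝔤 × 𝔤) →L[ℝ] 𝔤 :=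
  (ContinuousLinearMap.fst ℝ 𝔤 𝔤).comp (NormedSpace.exp (t • gaugeGen g))

lemma contDiff_gaugeOp : ContDiff ℝ ∞ (fun p : ℝ × 𝔤 ↦ gaugeOp p.1 p.2) := by
  have : CompleteSpace 𝔤 := FiniteDimensional.complete ℝ 𝔤
  have h1 : ContDiff ℝ ∞ (NormedSpace.exp : ((𝔤 × 𝔤) →L[ℝ] (𝔤 × 𝔤)) → _) :=
    contDiff_iff_contDiffAt.2 fun x ↦ (NormedSpace.exp_analytic (𝕂 := ℝ) x).contDiffAt
  exact contDiff_const.clm_comp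
    (h1.comp (contDiff_fst.smul (contDiff_gaugeGen.comp contDiff_snd)))

lemma gaugeOp_zero (g : 𝔤) : gaugeOp 0 g = ContinuousLinearMap.fst ℝ 𝔤 𝔤 := by
  rw [gaugeOp, zero_smul, NormedSpace.exp_zero]
  rfl

lemma hasDerivAt_gaugeOp (g : 𝔤) (t : ℝ) :
    HasDerivAt (fun t ↦ gaugeOp t g)
      (ContinuousLinearMap.snd ℝ 𝔤 𝔤 - (bracketL 𝔤 g).comp (gaugeOp t g)) t := by
  have : CompleteSpace 𝔤 := FiniteDimensional.complete ℝ 𝔤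
  have h0 := hasDerivAt_exp_smul_const' (𝕂 := ℝ) (gaugeGen g)
  -- The generator takes values in `𝔤 × 0`, so the second component, the inhomogeneity `b`, is
  -- constant in time.
  have h2 : ∀ (z : 𝔤 × 𝔤) (t : ℝ), (NormedSpace.exp (t • gaugeGen g) z).2 = z.2 := by
    intro z t
    have h3 : ∀ t, HasDerivAt (fun t : ℝ ↦ (NormedSpace.exp (t • gaugeGen g) z).2) 0 t := fun t ↦
      ((ContinuousLinearMap.snd ℝ 𝔤 𝔤).comp
        (ContinuousLinearMap.apply ℝ (𝔤 × 𝔤) z)).hasFDerivAt.comp_hasDerivAt t (h0 t)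
    have h4 := is_const_of_deriv_eq_zero (fun t ↦ (h3 t).differentiableAt) (fun t ↦ (h3 t).deriv) t 0
    rw [h4, zero_smul, NormedSpace.exp_zero]
    rfl
  have h5 := (ContinuousLinearMap.compL ℝ (𝔤 × 𝔤) (𝔤 × 𝔤) 𝔤
    (ContinuousLinearMap.fst ℝ 𝔤 𝔤)).hasFDerivAt.comp_hasDerivAt t (h0 t)
  convert! h5 using 1
  refine ContinuousLinearMap.ext fun z ↦ ?_
  change z.2 - _ = (NormedSpace.exp (t • gaugeGen g) z).2 - _
  rw [h2]
  rfl

lemma contDiff_clm_prod {E F G : Type*} [NormedAddCommGroup E] [NormedSpace ℝ E]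
    [NormedAddCommGroup F] [NormedSpace ℝ F] [NormedAddCommGroup G] [NormedSpace ℝ G] :
    ContDiff ℝ ∞ (fun p : (E →L[ℝ] F) × (E →L[ℝ] G) ↦ p.1.prod p.2) :=
  (ContinuousLinearMap.prodₗᵢ ℝ :
    ((E →L[ℝ] F) × (E →L[ℝ] G)) ≃ₗᵢ[ℝ] (E →L[ℝ] F × G)).toContinuousLinearEquiv.contDiff

end Bracket

section Gauge

variable {m : ℕ} {M : Type*} [TopologicalSpace M] [ChartedSpace (EuclideanSpace ℝ (Fin m)) M]
  [IsManifold (𝓡 m) ∞ M] {𝔤 : Type*} [NormedLieRing 𝔤] [NormedLieAlgebra 𝔤]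

/-- The differential of a function as a one-form. -/
noncomputable def differentialForm (f : M → 𝔤) : RoughOneForm m M 𝔤 :=
  fun x ↦ mfderiv (𝓡 m) 𝓘(ℝ, 𝔤) f x

lemma chartForm_differentialForm {f : M → 𝔤} (hf : ContMDiff (𝓡 m) 𝓘(ℝ, 𝔤) ∞ f) (x₀ : M)
    {ξ : EuclideanSpace ℝ (Fin m)} (hξ : ξ ∈ chartDom x₀) :
    chartForm x₀ (differentialForm f) ξ = fderiv ℝ (fun ξ ↦ f (chartInv x₀ ξ)) ξ := by
  ext v
  exact mfderiv_chartInvDeriv x₀ f hξ (((contMDiffAt_iff_contDiffAt_chart x₀ f hξ).1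
    (hf _)).differentiableAt (by simp)) v

variable [FiniteDimensional ℝ 𝔤]

/-- The orbit of a one-form under the gauge transformations `exp (t f)`. -/
noncomputable def gaugeOrbit (α : RoughOneForm m M 𝔤) (f : M → 𝔤) (t : ℝ) : RoughOneForm m M 𝔤 :=
  fun x ↦ (gaugeOp t (f x)).comp ((α x).prod (differentialForm f x))

/-- The derivative `df + [α, f]` of the gauge orbit at `t = 0`. -/
noncomputable def gaugeVariation (α : RoughOneForm m M 𝔤) (f : M → 𝔤) : RoughOneForm m M 𝔤 :=
  fun x ↦ differentialForm f x - (bracketL 𝔤 (f x)).comp (α x)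

omit [IsManifold (𝓡 m) ∞ M] in
lemma gaugeVariation_apply (α : RoughOneForm m M 𝔤) (f : M → 𝔤) (x : M)
    (v : TangentSpace (𝓡 m) x) :
    gaugeVariation α f x v = dirDeriv f x v + ⁅α x v, f x⁆ := by
  rw [← lie_skew (α x v), ← sub_eq_add_neg]
  rfl

-- The curvature of the orbit solves the homogeneous linear equation `F' = -[h, F]` with `F 0 = 0`.
-- The terms in `dh` cancel, the second derivative of `h` is symmetric, and the rest is the Jacobi
-- identity.
set_option synthInstance.maxHeartbeats 200000 in
lemma flatExtDeriv_gauge {E : Type*} [NormedAddCommGroup E] [NormedSpace ℝ E]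
    {U : Set E} (hU : IsOpen U) {a : E → E →L[ℝ] 𝔤} {h : E → 𝔤} (ha : ContDiffOn ℝ ∞ a U)
    (hh : ContDiffOn ℝ ∞ h U)
    (hflat : ∀ ξ ∈ U, ∀ v w, flatExtDeriv a ξ v w + ⁅a ξ v, a ξ w⁆ = 0) (t : ℝ)
    {ξ : E} (hξ : ξ ∈ U) (v w : E) :
    flatExtDeriv (fun ζ ↦ (gaugeOp t (h ζ)).comp ((a ζ).prod (fderiv ℝ h ζ))) ξ v w +
      ⁅gaugeOp t (h ξ) (a ξ v, fderiv ℝ h ξ v), gaugeOp t (h ξ) (a ξ w, fderiv ℝ h ξ w)⁆ = 0 := by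
  let b : ℝ × E → E →L[ℝ] 𝔤 := fun p ↦ (gaugeOp p.1 (h p.2)).comp ((a p.2).prod (fderiv ℝ h p.2))
  have hat : ∀ ζ ∈ U, ContDiffAt ℝ ∞ h ζ := fun ζ hζ ↦ (hh ζ hζ).contDiffAt (hU.mem_nhds hζ)
  have hdh : ContDiffAt ℝ ∞ (fderiv ℝ h) ξ := (hat ξ hξ).fderiv_right (by simp)
  have hb : ∀ s, ContDiffAt ℝ ∞ b (s, ξ) := by
    intro s
    have h1 : ContDiffAt ℝ ∞ (fun p : ℝ × E ↦ gaugeOp p.1 (h p.2)) (s, ξ) :=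
      (contDiff_gaugeOp (𝔤 := 𝔤)).contDiffAt.comp (s, ξ)
        (contDiffAt_fst.prodMk ((hat ξ hξ).comp (s, ξ) contDiffAt_snd))
    have h2 : ContDiffAt ℝ ∞ (fun p : ℝ × E ↦ (a p.2).prod (fderiv ℝ h p.2)) (s, ξ) := by
      have h3 : ContDiffAt ℝ ∞ (fun ζ ↦ (a ζ).prod (fderiv ℝ h ζ)) ξ := by
        exact (contDiff_clm_prod (E := E) (F := 𝔤) (G := 𝔤)).contDiffAt.comp ξ
          (((ha ξ hξ).contDiffAt (hU.mem_nhds hξ)).prodMk hdh)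
      exact h3.comp (s, ξ) contDiffAt_snd
    exact h1.clm_comp h2
  have hbt : ∀ s, ∀ ζ, HasDerivAt (fun s ↦ b (s, ζ))
      (fderiv ℝ h ζ - (bracketL 𝔤 (h ζ)).comp (b (s, ζ))) s := by
    intro s ζ
    have h1 := (hasDerivAt_gaugeOp (h ζ) s).clm_comp
      (hasDerivAt_const s ((a ζ).prod (fderiv ℝ h ζ)))
    convert! h1 using 1
    ext v
    simp [b]
  let F : ℝ → 𝔤 := fun s ↦ flatExtDeriv (fun ζ ↦ b (s, ζ)) ξ v w + ⁅b (s, ξ) v, b (s, ξ) w⁆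
  have hF : ∀ s, HasDerivAt F (-(bracketL 𝔤 (h ξ)) (F s)) s := by
    intro s
    have hbs : DifferentiableAt ℝ (fun ζ ↦ b (s, ζ)) ξ :=
      ((hb s).comp ξ (contDiffAt_const.prodMk contDiffAt_id)).differentiableAt (by simp)
    have h1 := hasDerivAt_fderiv_of_contDiffAt (hb s)
    have h2 : (fun ζ ↦ deriv (fun s ↦ b (s, ζ)) s) =
        fun ζ ↦ fderiv ℝ h ζ - (bracketL 𝔤 (h ζ)).comp (b (s, ζ)) :=
      funext fun ζ ↦ (hbt s ζ).deriv
    have h3' : HasFDerivAt (fun ζ ↦ (bracketL 𝔤 (h ζ)).comp (b (s, ζ))) _ ξ :=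
      ((bracketL 𝔤).hasFDerivAt.comp ξ ((hat ξ hξ).differentiableAt (by simp)).hasFDerivAt).clm_comp
        hbs.hasFDerivAt
    have h3 : HasFDerivAt (fun ζ ↦ fderiv ℝ h ζ - (bracketL 𝔤 (h ζ)).comp (b (s, ζ))) _ ξ :=
      (hdh.differentiableAt (by simp)).hasFDerivAt.sub h3'
    rw [h2, h3.fderiv] at h1
    have h4 : ∀ v w, HasDerivAt (fun s ↦ fderiv ℝ (fun ζ ↦ b (s, ζ)) ξ v w)
        (fderiv ℝ (fderiv ℝ h) ξ v w - (⁅h ξ, fderiv ℝ (fun ζ ↦ b (s, ζ)) ξ v w⁆ +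
          ⁅fderiv ℝ h ξ v, b (s, ξ) w⁆)) s := fun v w ↦ by
      have h8 := (h1.clm_apply (hasDerivAt_const s v)).clm_apply (hasDerivAt_const s w)
      convert! h8 using 1
      simp
    have h5 : ∀ v, HasDerivAt (fun s ↦ b (s, ξ) v) (fderiv ℝ h ξ v - ⁅h ξ, b (s, ξ) v⁆) s :=
      fun v ↦ (ContinuousLinearMap.apply ℝ 𝔤 v).hasFDerivAt.comp_hasDerivAt s (hbt s ξ)
    have h6 : HasDerivAt (fun s ↦ ⁅b (s, ξ) v, b (s, ξ) w⁆)
        (⁅fderiv ℝ h ξ v - ⁅h ξ, b (s, ξ) v⁆, b (s, ξ) w⁆ +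
          ⁅b (s, ξ) v, fderiv ℝ h ξ w - ⁅h ξ, b (s, ξ) w⁆⁆) s :=
      ((bracketL 𝔤).hasFDerivAt.comp_hasDerivAt s (h5 v)).clm_apply (h5 w)
    have h7 := ((h4 v w).sub (h4 w v)).add h6
    convert! h7 using 1
    have hs : fderiv ℝ (fderiv ℝ h) ξ v w = fderiv ℝ (fderiv ℝ h) ξ w v :=
      (hat ξ hξ).isSymmSndFDerivAt
        (by simpa using WithTop.coe_le_coe.2 (OrderTop.le_top (2 : ℕ∞))) v w
    have hj := leibniz_lie (h ξ) (b (s, ξ) v) (b (s, ξ) w)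
    have hk := lie_skew (fderiv ℝ h ξ w) (b (s, ξ) v)
    simp only [F, flatExtDeriv, bracketL_apply, lie_add, lie_sub, sub_lie, hs, hj, ← hk]
    abel
  have hz := ODE_solution_unique_univ (v := fun _ x ↦ -(bracketL 𝔤 (h ξ)) x)
    (s := fun _ ↦ univ) (f := F) (g := fun _ ↦ 0) (t₀ := 0)
    (fun _ ↦ (-(bracketL 𝔤 (h ξ))).lipschitz.lipschitzOnWith)
    (fun s ↦ ⟨hF s, mem_univ _⟩)
    (fun s ↦ ⟨by simpa using hasDerivAt_const s (0 : 𝔤), mem_univ _⟩) (by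
      have := hflat ξ hξ v w
      simp only [F, b, gaugeOp_zero]
      exact this)
  exact congrFun hz t

/-- The gauge orbit is the required curve. `gaugeOp` is jointly smooth in time and its parameter,
and flatness at all times is checked chart by chart. -/
theorem gaugeVariation_mem_tangent [T2Space M] {α : RoughOneForm m M 𝔤} (hα : α ∈ MaurerCartanForms)
    {f : M → 𝔤} (hf : ContMDiff (𝓡 m) 𝓘(ℝ, 𝔤) ∞ f) :
    gaugeVariation α f ∈ tangentMaurerCartan α := by
  obtain ⟨hαs, hαf⟩ := (mem_maurerCartanForms_iff α).1 hα
  rw [isSmoothOneForm_iff] at hαs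
  have hfs := (contMDiff_iff_contDiffOn_chart f).1 hf
  have hchart : ∀ t, ∀ x₀ : M, ∀ ξ ∈ chartDom x₀, chartForm x₀ (gaugeOrbit α f t) ξ =
      (gaugeOp t (f (chartInv x₀ ξ))).comp ((chartForm x₀ α ξ).prod
        (fderiv ℝ (fun ξ ↦ f (chartInv x₀ ξ)) ξ)) := by
    intro t x₀ ξ hξ
    rw [← chartForm_differentialForm hf x₀ hξ]
    rfl
  have hsm : IsSmoothCurveOfForms 1 (gaugeOrbit α f) := by
    rw [isSmoothCurveOfForms_iff]
    intro x₀
    have hT := isOpen_chartDom (m := m) x₀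
    refine ContDiffOn.congr ?_ fun p hp ↦ hchart p.1 x₀ p.2 hp.2
    have h1 : ContDiffOn ℝ ∞ (fun p : ℝ × EuclideanSpace ℝ (Fin m) ↦
        gaugeOp p.1 (f (chartInv x₀ p.2))) (Ioo (-1) 1 ×ˢ chartDom x₀) :=
      contDiff_gaugeOp.comp_contDiffOn (contDiffOn_fst.prodMk
        ((hfs x₀).comp contDiffOn_snd fun p hp ↦ hp.2))
    refine h1.clm_comp ?_
    exact contDiff_clm_prod.comp_contDiffOn
      (((hαs x₀).prodMk ((hfs x₀).fderiv_of_isOpen hT (by simp))).comp contDiffOn_snd fun p hp ↦ hp.2)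
  refine ⟨1, one_pos, gaugeOrbit α f, hsm, ?_, fun t ht ↦ ?_, fun x v ↦ ?_⟩
  · funext x
    ext v
    change gaugeOp 0 (f x) _ = _
    rw [gaugeOp_zero]
    rfl
  · rw [mem_maurerCartanForms_iff, isSmoothOneForm_iff]
    refine ⟨fun x₀ ↦ ?_, fun x₀ ξ hξ v w ↦ ?_⟩
    · exact ((isSmoothCurveOfForms_iff _ _).1 hsm x₀).comp
        (contDiff_const (c := t).prodMk contDiff_id).contDiffOn fun ξ hξ ↦ ⟨ht, hξ⟩
    · have h1 := flatExtDeriv_gauge (isOpen_chartDom x₀) (hαs x₀) (hfs x₀) (hαf x₀) t hξ v w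
      have h2 : chartForm x₀ (gaugeOrbit α f t) =ᶠ[𝓝 ξ] fun ξ ↦
          (gaugeOp t (f (chartInv x₀ ξ))).comp ((chartForm x₀ α ξ).prod
            (fderiv ℝ (fun ξ ↦ f (chartInv x₀ ξ)) ξ)) :=
        Filter.eventually_of_mem ((isOpen_chartDom x₀).mem_nhds hξ) (hchart t x₀)
      rw [flatExtDeriv, h2.fderiv_eq, hchart t x₀ ξ hξ]
      exact h1
  · have h1 := (ContinuousLinearMap.apply ℝ 𝔤
      ((α x v, differentialForm f x v) : 𝔤 × 𝔤)).hasFDerivAt.comp_hasDerivAt 0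
        (hasDerivAt_gaugeOp (f x) 0)
    rw [gaugeOp_zero] at h1
    exact h1

end Gauge

end HorizontalForms

namespace HorizontalForms

open Filter Topology

/-! ### Regularity from strong bracket generation: part (b) -/

section Regular

variable {m : ℕ} {M : Type*} [TopologicalSpace M] [ChartedSpace (EuclideanSpace ℝ (Fin m)) M]

/-- A surjective linear system with smooth coefficients is smoothly solvable near a point. -/
lemma exists_contMDiffOn_solution {V W : Type*} [NormedAddCommGroup V] [NormedSpace ℝ V]
    [FiniteDimensional ℝ V] [NormedAddCommGroup W] [NormedSpace ℝ W]
    {L : M → W →L[ℝ] V} (hL : ContMDiff (𝓡 m) 𝓘(ℝ, W →L[ℝ] V) ∞ L)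
    {φ : M → V} (hφ : ContMDiff (𝓡 m) 𝓘(ℝ, V) ∞ φ) {x₀ : M} (hsurj : Function.Surjective (L x₀)) :
    ∃ U ∈ 𝓝 x₀, ∃ B : M → W, ContMDiffOn (𝓡 m) 𝓘(ℝ, W) ∞ B U ∧ ∀ y ∈ U, L y (B y) = φ y := by
  have : CompleteSpace V := FiniteDimensional.complete ℝ V
  -- A right inverse `R` of `L x₀` makes `L y ∘ R` invertible for `y` near `x₀`, and `R (L y ∘ R)⁻¹
  -- φ` is then a smooth solution.
  obtain ⟨R, hR⟩ := (L x₀ : W →ₗ[ℝ] V).exists_rightInverse_of_surjective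
    (LinearMap.range_eq_top.2 hsurj)
  let R' : V →L[ℝ] W := LinearMap.toContinuousLinearMap R
  let A : M → V →L[ℝ] V := fun y ↦ (L y).comp R'
  have hA : ContMDiff (𝓡 m) 𝓘(ℝ, V →L[ℝ] V) ∞ A := hL.clm_comp contMDiff_const
  have hA0 : A x₀ = 1 := by
    ext v
    exact DFunLike.congr_fun hR v
  refine ⟨{y | IsUnit (A y)}, (Units.isOpen.preimage hA.continuous).mem_nhds ?_,
    fun y ↦ R' (Ring.inverse (A y) (φ y)), ?_, ?_⟩
  · change IsUnit (A x₀)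
    rw [hA0]
    exact isUnit_one
  · rintro y ⟨u, hu⟩
    have h1 : ContDiffAt ℝ ∞ (Ring.inverse : (V →L[ℝ] V) → _) (A y) := by
      rw [← hu]
      exact contDiffAt_ringInverse ℝ u
    have h2 := ContMDiffAt.comp y h1.contMDiffAt (hA y)
    exact (ContMDiffAt.clm_apply (contMDiffAt_const (c := R'))
      (h2.clm_apply (hφ y))).contMDiffWithinAt
  · intro y hy
    exact DFunLike.congr_fun (Ring.mul_inverse_cancel _ hy) (φ y)

variable [IsManifold (𝓡 m) ∞ M] {𝔤 : Type*} [NormedLieRing 𝔤] [NormedLieAlgebra 𝔤]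

lemma contMDiff_apply_field {α : RoughOneForm m M 𝔤} (hα : IsSmoothOneForm α)
    {X : ∀ x : M, TangentSpace (𝓡 m) x} (hX : IsSmoothField X) :
    ContMDiff (𝓡 m) 𝓘(ℝ, 𝔤) ∞ (fun x ↦ α x (X x)) := by
  refine (contMDiff_iff_contDiffOn_chart _).2 fun x₀ ξ hξ ↦ ?_
  have h1 := ((isSmoothOneForm_iff α).1 hα x₀ ξ hξ).clm_apply
    (contDiffAt_chartField x₀ X hX hξ).contDiffWithinAt
  exact h1.congr (fun ζ hζ ↦ (chartForm_chartField x₀ α X hζ).symm)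
    (chartForm_chartField x₀ α X hξ).symm

variable [T2Space M] {k : ℕ}

/-- Near every point, `D` has a smooth frame consisting of globally defined sections. -/
lemma exists_global_frame (S : SubRiemannianStructure m M k) (x₀ : M) :
    ∃ X : Fin k → ∀ x : M, S.D x, (∀ i, IsSmoothField (fun x ↦ (X i x : TangentSpace (𝓡 m) x))) ∧
      ∀ᶠ x in 𝓝 x₀, LinearIndependent ℝ (fun i ↦ (X i x : TangentSpace (𝓡 m) x)) ∧
        Submodule.span ℝ (range fun i ↦ (X i x : TangentSpace (𝓡 m) x)) = S.D x := by
  obtain ⟨U, hU, hx, X, hX, hXs⟩ := S.exists_frame x₀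
  choose ψ h1 h0 hs using fun i ↦ exists_smoothField_eventuallyEq x₀ hU hx (X i) (hX i)
  have hmem : ∀ i x, ψ i x • X i x ∈ S.D x := by
    intro i x
    by_cases hxU : x ∈ U
    · refine (S.D x).smul_mem _ ?_
      rw [← (hXs x hxU).2]
      exact Submodule.subset_span ⟨i, rfl⟩
    · rw [h0 i x hxU, zero_smul]
      exact zero_mem _
  refine ⟨fun i x ↦ ⟨_, hmem i x⟩, hs, ?_⟩
  filter_upwards [hU.mem_nhds hx, eventually_all.2 h1] with x hxU hψ
  simpa only [hψ, one_smul] using hXs x hxU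

variable [FiniteDimensional ℝ 𝔤]

/-- If `𝔢` is strongly bracket generating and `α` is injective on `D`, every smooth partial form
is of the form `v ↦ [α(v), f]` modulo `𝔢`, for a smooth function `f` with values in `𝔢`. -/
theorem exists_smooth_bracket_preimage [SecondCountableTopology M] (hk : 1 ≤ k)
    (S : SubRiemannianStructure m M k) {𝔢 : Submodule ℝ 𝔤} {α : RoughOneForm m M 𝔤}
    (hα : α ∈ HorizontalMaurerCartanForms S.D 𝔢) (hstrong : IsStronglyBracketGenerating k 𝔢)
    (hinj : ∀ x, ∀ v ∈ S.D x, α x v = 0 → v = 0) {φ : ∀ x : M, S.D x →ₗ[ℝ] 𝔤 ⧸ 𝔢}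
    (hφ : IsSmoothPartialForm S.D 𝔢 φ) :
    ∃ f : M → 𝔤, ContMDiff (𝓡 m) 𝓘(ℝ, 𝔤) ∞ f ∧ (∀ x, f x ∈ 𝔢) ∧
      ∀ x, ∀ v : S.D x, 𝔢.mkQ ⁅α x v, f x⁆ = φ x v := by
  have : LocallyCompactSpace M := ChartedSpace.locallyCompactSpace (EuclideanSpace ℝ (Fin m)) M
  -- Coordinates on the quotient, so that smoothness and inversion take place in a concrete normed
  -- space.
  let κ := (Module.finBasis ℝ (𝔤 ⧸ 𝔢)).equivFun
  let t : M → Set 𝔤 := fun x ↦ {B | B ∈ 𝔢 ∧ ∀ v : S.D x, 𝔢.mkQ ⁅α x v, B⁆ = φ x v}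
  have ht : ∀ x, Convex ℝ (t x) := by
    rintro x a ⟨ha, ha'⟩ b ⟨hb, hb'⟩ r s - - hrs
    refine ⟨𝔢.add_mem (𝔢.smul_mem r ha) (𝔢.smul_mem s hb), fun v ↦ ?_⟩
    rw [lie_add, lie_smul, lie_smul, map_add, map_smul, map_smul, ha', hb', ← add_smul, hrs,
      one_smul]
  let T : (Fin k → 𝔤) →L[ℝ] 𝔢 →L[ℝ] (Fin k → Fin (Module.finrank ℝ (𝔤 ⧸ 𝔢)) → ℝ) :=
    LinearMap.toContinuousLinearMap ((LinearMap.toContinuousLinearMap :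
      (𝔢 →ₗ[ℝ] (Fin k → Fin (Module.finrank ℝ (𝔤 ⧸ 𝔢)) → ℝ)) ≃ₗ[ℝ] _).toLinearMap ∘ₗ
      LinearMap.mk₂ ℝ (fun a B i ↦ κ (𝔢.mkQ ⁅a i, (B : 𝔤)⁆))
        (fun a b B ↦ by ext i; simp) (fun c a B ↦ by ext i; simp)
        (fun a B C ↦ by ext i; simp) (fun c a B ↦ by ext i; simp))
  have hT : ∀ a B i, T a B i = κ (𝔢.mkQ ⁅a i, (B : 𝔤)⁆) := fun _ _ _ ↦ rfl
  have hloc : ∀ x : M, ∃ U ∈ 𝓝 x, ∃ g : M → 𝔤, ContMDiffOn (𝓡 m) 𝓘(ℝ, 𝔤) ∞ g U ∧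
      ∀ y ∈ U, g y ∈ t y := by
    intro x₀
    obtain ⟨X, hX, hXs⟩ := exists_global_frame S x₀
    have hL : ContMDiff (𝓡 m) 𝓘(ℝ, 𝔢 →L[ℝ] (Fin k → Fin (Module.finrank ℝ (𝔤 ⧸ 𝔢)) → ℝ)) ∞
        (fun x ↦ T (fun i ↦ α x (X i x))) :=
      ContMDiff.clm_apply contMDiff_const
        (contMDiff_pi_space.2 fun i ↦ contMDiff_apply_field hα.1.1 (hX i))
    have hR : ContMDiff (𝓡 m) 𝓘(ℝ, Fin k → Fin (Module.finrank ℝ (𝔤 ⧸ 𝔢)) → ℝ) ∞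
        (fun x i ↦ κ (φ x (X i x))) :=
      contMDiff_pi_space.2 fun i ↦ contMDiff_pi_space.2 fun j ↦
        hφ (X i) (hX i) (LinearMap.proj j ∘ₗ κ.toLinearMap)
    obtain ⟨U, hU, B, hB, hBs⟩ := exists_contMDiffOn_solution hL hR (x₀ := x₀) (by
      intro z
      obtain ⟨hli, -⟩ := hXs.self_of_nhds
      have hli' : LinearIndependent ℝ (fun i ↦ α x₀ (X i x₀)) := by
        have hli2 : LinearIndependent ℝ (fun i ↦ X i x₀) :=
          LinearIndependent.of_comp (S.D x₀).subtype hli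
        exact hli2.map' ((α x₀ : TangentSpace (𝓡 m) x₀ →ₗ[ℝ] 𝔤) ∘ₗ (S.D x₀).subtype)
          (LinearMap.ker_eq_bot'.2 fun v hv ↦ Subtype.ext (hinj x₀ v v.2 hv))
      choose Z hZ using fun i ↦ 𝔢.mkQ_surjective (κ.symm (z i))
      -- Injectivity of `α` on `D` keeps the images of the frame independent, so the bracket
      -- condition applies with `l = k` and gives surjectivity of the linear system at `x₀`.
      obtain ⟨B, hB, hBZ⟩ := hstrong k hk le_rfl _ (fun i ↦ hα.2 x₀ _ (X i x₀).2) hli' Z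
      refine ⟨⟨B, hB⟩, funext fun i ↦ ?_⟩
      have h1 : 𝔢.mkQ (Z i) = 𝔢.mkQ ⁅α x₀ (X i x₀), B⁆ :=
        (Submodule.Quotient.eq 𝔢).2 (hBZ i)
      rw [hT, ← h1, hZ, LinearEquiv.apply_symm_apply])
    refine ⟨_, inter_mem hU hXs, fun y ↦ B y, ?_, ?_⟩
    · exact ContMDiffOn.clm_apply (contMDiffOn_const (c := 𝔢.subtypeL))
        (hB.mono inter_subset_left)
    · rintro y ⟨hyU, -, hyX⟩
      refine ⟨(B y).2, ?_⟩
      let l : S.D y →ₗ[ℝ] 𝔤 ⧸ 𝔢 := 𝔢.mkQ ∘ₗ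
        (LinearMap.toContinuousLinearMap.symm ((bracketL 𝔤).flip (B y))) ∘ₗ
        (α y : TangentSpace (𝓡 m) y →ₗ[ℝ] 𝔤) ∘ₗ (S.D y).subtype
      have hl : ∀ i, l (X i y) = φ y (X i y) := fun i ↦
        κ.injective (congrFun (hBs y hyU) i)
      have hspan : Submodule.span ℝ (range fun i ↦ X i y) = ⊤ := by
        apply Submodule.map_injective_of_injective (S.D y).injective_subtype
        rw [Submodule.map_span, ← range_comp, Submodule.map_subtype_top]
        exact hyX
      have h2 : l = φ y := LinearMap.ext_on_range hspan hl
      exact fun v ↦ DFunLike.congr_fun h2 v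
  -- Partition of unity: the admissible values at each point form a convex set.
  obtain ⟨g, hg⟩ := exists_contMDiffMap_forall_mem_convex_of_local (𝓡 m) (n := ⊤) ht hloc
  exact ⟨g, g.contMDiff, fun x ↦ (hg x).1, fun x ↦ (hg x).2⟩

omit [IsManifold (𝓡 m) ∞ M] [T2Space M] in
/-- The derivative of a function with values in a subspace has values in this subspace. -/
lemma dirDeriv_mem {𝔢 : Submodule ℝ 𝔤} {f : M → 𝔤} {x : M}
    (hf : MDifferentiableAt (𝓡 m) 𝓘(ℝ, 𝔤) f x) (hfe : ∀ x, f x ∈ 𝔢) (v : TangentSpace (𝓡 m) x) :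
    dirDeriv f x v ∈ 𝔢 := by
  rw [← Submodule.Quotient.mk_eq_zero, ← Submodule.mkQ_apply]
  let κ := (Module.finBasis ℝ (𝔤 ⧸ 𝔢)).equivFun
  let c : 𝔤 →L[ℝ] (Fin (Module.finrank ℝ (𝔤 ⧸ 𝔢)) → ℝ) :=
    LinearMap.toContinuousLinearMap (κ.toLinearMap ∘ₗ 𝔢.mkQ)
  have h1 := mfderiv_comp x (c.differentiableAt.mdifferentiableAt (x := f x)) hf
  have h2 : c ∘ f = fun _ ↦ 0 := by
    funext y
    change κ (𝔢.mkQ (f y)) = 0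
    rw [Submodule.mkQ_apply, (Submodule.Quotient.mk_eq_zero 𝔢).2 (hfe y), map_zero]
  rw [h2, mfderiv_const, mfderiv_eq_fderiv, c.fderiv] at h1
  exact κ.injective ((DFunLike.congr_fun h1 v).symm.trans (map_zero κ).symm)

theorem isRegular_of_isStronglyBracketGenerating [SecondCountableTopology M] (hk : 1 ≤ k)
    (S : SubRiemannianStructure m M k) {𝔢 : Submodule ℝ 𝔤} {α : RoughOneForm m M 𝔤}
    (hα : α ∈ HorizontalMaurerCartanForms S.D 𝔢) (hstrong : IsStronglyBracketGenerating k 𝔢)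
    (hinj : ∀ x, ∀ v ∈ S.D x, α x v = 0 → v = 0) : IsRegular S.D 𝔢 α := by
  intro φ hφ
  obtain ⟨f, hf, hfe, hfφ⟩ := exists_smooth_bracket_preimage hk S hα hstrong hinj hφ
  refine ⟨gaugeVariation α f, gaugeVariation_mem_tangent hα.1 hf, funext fun x ↦
    LinearMap.ext fun v ↦ ?_⟩
  change 𝔢.mkQ (gaugeVariation α f x v) = _
  rw [gaugeVariation_apply, map_add, hfφ, Submodule.mkQ_apply, (Submodule.Quotient.mk_eq_zero 𝔢).2
    (dirDeriv_mem ((hf x).mdifferentiableAt (by simp)) hfe v), zero_add]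

end Regular

end HorizontalForms

namespace HorizontalForms

open Filter Topology

/-! ### Global solutions of flat linear systems on simply connected manifolds -/

section Parallel

variable {m : ℕ} {M : Type*} [TopologicalSpace M] [ChartedSpace (EuclideanSpace ℝ (Fin m)) M]
  [IsManifold (𝓡 m) ∞ M] {A : Type*} [NormedRing A] [NormedAlgebra ℝ A]

/-- `Φ` is an invertible solution of `dΦ = Θ Φ` over `U`. -/
def IsFundamentalSolution (Θ : ∀ x : M, TangentSpace (𝓡 m) x →L[ℝ] A) (Φ : M → A)
    (U : Set M) : Prop :=
  ∀ x ∈ U, ContMDiffAt (𝓡 m) 𝓘(ℝ, A) ∞ Φ x ∧ IsUnit (Φ x) ∧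
    ∀ v : TangentSpace (𝓡 m) x, mfderiv (𝓡 m) 𝓘(ℝ, A) Φ x v = Θ x v * Φ x

variable [CompleteSpace A]

lemma exists_isFundamentalSolution (Θ : ∀ x : M, TangentSpace (𝓡 m) x →L[ℝ] A) (i : M)
    (hΘ : ContDiffOn ℝ ∞ (fun ξ ↦ (Θ (chartInv i ξ)).comp (chartInvDeriv i ξ)) (chartDom i))
    (hflat : ∀ ξ ∈ chartDom i, ∀ v w, flatExtDeriv
      (fun ξ ↦ (Θ (chartInv i ξ)).comp (chartInvDeriv i ξ)) ξ v w +
        Θ (chartInv i ξ) (chartInvDeriv i ξ w) * Θ (chartInv i ξ) (chartInvDeriv i ξ v) -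
        Θ (chartInv i ξ) (chartInvDeriv i ξ v) * Θ (chartInv i ξ) (chartInvDeriv i ξ w) = 0) :
    ∃ U : Set M, IsOpen U ∧ i ∈ U ∧ ∃ Φ, IsFundamentalSolution Θ Φ U := by
  obtain ⟨V, hVU, hV, hiV, Φ, hΦ, hΦu, hΦs⟩ := exists_local_solution (isOpen_chartDom i) _ hΘ hflat
    _ (chart_mem_chartDom i (mem_chart_source (EuclideanSpace ℝ (Fin m)) i))
  refine ⟨_, (continuousOn_extChartAt (I := 𝓡 m) i).isOpen_inter_preimage
    (isOpen_extChartAt_source i) hV, ⟨mem_extChartAt_source i, hiV⟩,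
    fun x ↦ Φ (extChartAt (𝓡 m) i x), ?_⟩
  rintro x ⟨hx, hxV⟩
  rw [extChartAt_source] at hx
  obtain ⟨ξ, hξ, rfl⟩ : ∃ ξ ∈ V, chartInv i ξ = x := ⟨_, hxV, chartInv_chart i hx⟩
  have hξ' := hVU hξ
  have hev : (fun ζ ↦ Φ (extChartAt (𝓡 m) i (chartInv i ζ))) =ᶠ[𝓝 ξ] Φ := by
    filter_upwards [(isOpen_chartDom i).mem_nhds hξ'] with ζ hζ
    rw [chart_chartInv i hζ]
  have hc : ContDiffAt ℝ ∞ (fun ζ ↦ Φ (extChartAt (𝓡 m) i (chartInv i ζ))) ξ :=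
    (hΦ.contDiffAt (hV.mem_nhds hξ)).congr_of_eventuallyEq hev
  refine ⟨(contMDiffAt_iff_contDiffAt_chart i _ hξ').2 hc, ?_, fun v ↦ ?_⟩
  · simpa only [chart_chartInv i hξ'] using hΦu ξ hξ
  · obtain ⟨h, rfl⟩ := (isInvertible_chartInvDeriv i hξ').surjective v
    rw [mfderiv_chartInvDeriv i _ hξ' (hc.differentiableAt (by simp)), hev.fderiv_eq,
      hΦs ξ hξ]
    exact congrArg (fun ζ ↦ Θ (chartInv i ξ) (chartInvDeriv i ξ h) * Φ ζ) (chart_chartInv i hξ').symm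

/-- This is the cocycle condition for gluing: transition factors between local solutions are locally
constant. -/
lemma IsFundamentalSolution.eventually_inverse_mul_eq
    {Θ : ∀ x : M, TangentSpace (𝓡 m) x →L[ℝ] A} {Φ Ψ : M → A}
    {U V : Set M} (hU : IsOpen U) (hV : IsOpen V) (hΦ : IsFundamentalSolution Θ Φ U)
    (hΨ : IsFundamentalSolution Θ Ψ V) {y : M} (hy : y ∈ U ∩ V) :
    ∀ᶠ z in 𝓝 y, Ring.inverse (Φ z) * Ψ z = Ring.inverse (Φ y) * Ψ y := by
  have hyc := mem_chart_source (EuclideanSpace ℝ (Fin m)) y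
  have hN : IsOpen (chartDom (m := m) y ∩ chartInv y ⁻¹' (U ∩ V)) :=
    ((contMDiffOn_chartInv y).continuousOn).isOpen_inter_preimage (isOpen_chartDom y) (hU.inter hV)
  have hd : ∀ {Φ : M → A} {U : Set M}, IsFundamentalSolution Θ Φ U → ∀ ξ ∈ chartDom y,
      chartInv y ξ ∈ U → DifferentiableAt ℝ (fun ξ ↦ Φ (chartInv y ξ)) ξ ∧ ∀ h,
        fderiv ℝ (fun ξ ↦ Φ (chartInv y ξ)) ξ h =
          (Θ (chartInv y ξ)).comp (chartInvDeriv y ξ) h * Φ (chartInv y ξ) := by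
    intro Φ U hΦ ξ hξ hξU
    obtain ⟨h1, -, h2⟩ := hΦ _ hξU
    have h3 := ((contMDiffAt_iff_contDiffAt_chart y Φ hξ).1 h1).differentiableAt (by simp)
    refine ⟨h3, fun h ↦ ?_⟩
    rw [← mfderiv_chartInvDeriv y Φ hξ h3, h2]
    rfl
  have h1 := HorizontalForms.eventually_inverse_mul_eq hN
    (fun ξ ↦ (Θ (chartInv y ξ)).comp (chartInvDeriv y ξ))
    (fun ξ ↦ Φ (chartInv y ξ)) (fun ξ ↦ Ψ (chartInv y ξ))
    (fun ξ hξ ↦ (hd hΦ ξ hξ.1 hξ.2.1).1) (fun ξ hξ ↦ (hd hΨ ξ hξ.1 hξ.2.2).1)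
    (fun ξ hξ ↦ (hΦ _ hξ.2.1).2.1)
    (fun ξ hξ ↦ (hd hΦ ξ hξ.1 hξ.2.1).2) (fun ξ hξ ↦ (hd hΨ ξ hξ.1 hξ.2.2).2)
    (extChartAt (𝓡 m) y y) ⟨chart_mem_chartDom y hyc, by rwa [mem_preimage, chartInv_chart y hyc]⟩
  have h2 := (continuousAt_extChartAt (I := 𝓡 m) y).eventually h1
  filter_upwards [h2, (chartAt _ y).open_source.mem_nhds hyc] with z hz hzs
  rwa [chartInv_chart y hzs, chartInv_chart y hyc] at hz

/-- On a simply connected manifold, a flat linear system of partial differential equations has a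
global solution with any initial value. -/
theorem exists_parallel_section [SimplyConnectedSpace M] {W : Type*} [NormedAddCommGroup W]
    [NormedSpace ℝ W] [CompleteSpace W] (Θ : ∀ x : M, TangentSpace (𝓡 m) x →L[ℝ] (W →L[ℝ] W))
    (hΘ : ∀ i, ContDiffOn ℝ ∞ (fun ξ ↦ (Θ (chartInv i ξ)).comp (chartInvDeriv i ξ)) (chartDom i))
    (hflat : ∀ i, ∀ ξ ∈ chartDom i, ∀ v w, flatExtDeriv
      (fun ξ ↦ (Θ (chartInv i ξ)).comp (chartInvDeriv i ξ)) ξ v w +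
        Θ (chartInv i ξ) (chartInvDeriv i ξ w) * Θ (chartInv i ξ) (chartInvDeriv i ξ v) -
        Θ (chartInv i ξ) (chartInvDeriv i ξ v) * Θ (chartInv i ξ) (chartInvDeriv i ξ w) = 0)
    (x₀ : M) (w₀ : W) :
    ∃ F : M → W, F x₀ = w₀ ∧ ContMDiff (𝓡 m) 𝓘(ℝ, W) ∞ F ∧
      ∀ x (v : TangentSpace (𝓡 m) x), mfderiv (𝓡 m) 𝓘(ℝ, W) F x v = Θ x v (F x) := by
  classical
  have : LocallyPathConnectedSpace M :=
    ChartedSpace.locallyPathConnectedSpace (EuclideanSpace ℝ (Fin m)) M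
  choose U hU hmem Φ hΦ using fun i ↦ exists_isFundamentalSolution Θ i (hΘ i) (hflat i)
  -- The default `1` only makes the permutations total; on `U i` the unit is `Φ i z`.
  let u : M → M → (W →L[ℝ] W)ˣ := fun i z ↦ if h : IsUnit (Φ i z) then h.unit else 1
  have hu : ∀ i, ∀ z ∈ U i, (u i z : W →L[ℝ] W) = Φ i z := by
    intro i z hz
    have h := (hΦ i z hz).2.1
    simp only [u, dif_pos h, IsUnit.unit_spec]
  have hu' : ∀ i, ∀ z ∈ U i, (((u i z)⁻¹ : (W →L[ℝ] W)ˣ) : W →L[ℝ] W) = Ring.inverse (Φ i z) := by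
    intro i z hz
    rw [← hu i z hz, Ring.inverse_unit]
  let τ : M → M → Equiv.Perm W := fun i z ↦ MulAction.toPermHom (W →L[ℝ] W)ˣ W (u i z)
  obtain ⟨F, hF0, hF⟩ := exists_section_of_locallyConstant U hU hmem τ (by
    intro i j y hy
    filter_upwards [(hΦ j).eventually_inverse_mul_eq (hU j) (hU i) (hΦ i) hy.symm,
      (hU i).mem_nhds hy.1, (hU j).mem_nhds hy.2] with z hz hzi hzj
    simp only [τ, ← map_inv, ← map_mul]
    congr 1
    refine Units.ext ?_
    rw [Units.val_mul, Units.val_mul, hu i z hzi, hu i y hy.1, hu' j z hzj, hu' j y hy.2, hz]) x₀ w₀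
  -- A locally constant coordinate means that `F` is locally a fundamental solution applied to a
  -- fixed vector, hence smooth and parallel.
  have hloc : ∀ y, ∃ w : W, F =ᶠ[𝓝 y] fun z ↦ Φ y z w := by
    intro y
    refine ⟨(τ y y)⁻¹ (F y), ?_⟩
    filter_upwards [hF y y (hmem y), (hU y).mem_nhds (hmem y)] with z hz hzU
    rw [← hz, ← hu y z hzU]
    exact ((τ y z).apply_symm_apply (F z)).symm
  refine ⟨F, hF0, fun y ↦ ?_, fun y v ↦ ?_⟩
  · obtain ⟨w, hw⟩ := hloc y
    exact ((hΦ y y (hmem y)).1.clm_apply contMDiffAt_const).congr_of_eventuallyEq hw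
  · obtain ⟨w, hw⟩ := hloc y
    obtain ⟨h1, -, h2⟩ := hΦ y y (hmem y)
    have h3 := mfderiv_comp y ((ContinuousLinearMap.apply ℝ W w).differentiableAt.mdifferentiableAt
      (x := Φ y y)) (h1.mdifferentiableAt (by simp))
    rw [mfderiv_eq_fderiv, ContinuousLinearMap.fderiv] at h3
    rw [hw.mfderiv_eq, hw.self_of_nhds]
    exact (DFunLike.congr_fun h3 v).trans (congrArg (fun a : W →L[ℝ] W ↦ a w) (h2 v))

end Parallel

end HorizontalForms

namespace HorizontalForms

open Filter Topology

/-! ### Tangent vectors of the Maurer-Cartan space as gauge variations -/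

section Tangent

lemma fderiv_comp_prod_apply {E E' F₁ F₂ G : Type*} [NormedAddCommGroup E] [NormedSpace ℝ E]
    [NormedAddCommGroup E'] [NormedSpace ℝ E'] [NormedAddCommGroup F₁] [NormedSpace ℝ F₁]
    [NormedAddCommGroup F₂] [NormedSpace ℝ F₂] [NormedAddCommGroup G] [NormedSpace ℝ G]
    (T : F₁ × F₂ →L[ℝ] G) {a : E → E' →L[ℝ] F₁} {b : E → E' →L[ℝ] F₂} {ξ : E}
    (ha : DifferentiableAt ℝ a ξ) (hb : DifferentiableAt ℝ b ξ) (v : E) (w : E') :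
    fderiv ℝ (fun ξ ↦ T.comp ((a ξ).prod (b ξ))) ξ v w = T (fderiv ℝ a ξ v w, fderiv ℝ b ξ v w) := by
  have h1 := (ContinuousLinearMap.prodₗᵢ ℝ : ((E' →L[ℝ] F₁) × (E' →L[ℝ] F₂)) ≃ₗᵢ[ℝ]
    (E' →L[ℝ] F₁ × F₂)).toContinuousLinearEquiv.hasFDerivAt.comp ξ
      (ha.hasFDerivAt.prodMk hb.hasFDerivAt)
  have h2 : HasFDerivAt (fun ξ ↦ T.comp ((a ξ).prod (b ξ))) _ ξ :=
    (ContinuousLinearMap.compL ℝ E' (F₁ × F₂) G T).hasFDerivAt.comp ξ h1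
  rw [h2.fderiv]
  rfl

variable {𝔤 : Type*} [NormedLieRing 𝔤] [NormedLieAlgebra 𝔤] [FiniteDimensional ℝ 𝔤]

/-- The linearization of the Maurer-Cartan equation. -/
lemma linearized_flat {E : Type*} [NormedAddCommGroup E] [NormedSpace ℝ E] {b : ℝ × E → E →L[ℝ] 𝔤}
    {ξ : E} (hb : ContDiffAt ℝ ∞ b (0, ξ)) (v w : E)
    (hflat : ∀ᶠ t in 𝓝 (0 : ℝ), flatExtDeriv (fun ζ ↦ b (t, ζ)) ξ v w +
      ⁅b (t, ξ) v, b (t, ξ) w⁆ = 0) :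
    flatExtDeriv (fun ζ ↦ deriv (fun t ↦ b (t, ζ)) 0) ξ v w +
      (⁅deriv (fun t ↦ b (t, ξ)) 0 v, b (0, ξ) w⁆ +
        ⁅b (0, ξ) v, deriv (fun t ↦ b (t, ξ)) 0 w⁆) = 0 := by
  have h1 := hasDerivAt_fderiv_of_contDiffAt hb
  have hd : HasDerivAt (fun t ↦ b (t, ξ)) (deriv (fun t ↦ b (t, ξ)) 0) 0 :=
    ((hb.comp (0 : ℝ) (contDiffAt_id.prodMk contDiffAt_const)).differentiableAt
      (by simp)).hasDerivAt
  have h4 : ∀ v w, HasDerivAt (fun s ↦ fderiv ℝ (fun ζ ↦ b (s, ζ)) ξ v w)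
      (fderiv ℝ (fun ζ ↦ deriv (fun t ↦ b (t, ζ)) 0) ξ v w) 0 := fun v w ↦ by
    have h8 := (h1.clm_apply (hasDerivAt_const 0 v)).clm_apply (hasDerivAt_const 0 w)
    convert! h8 using 1
    simp
  have h5 : ∀ v, HasDerivAt (fun t ↦ b (t, ξ) v) (deriv (fun t ↦ b (t, ξ)) 0 v) 0 :=
    fun v ↦ (ContinuousLinearMap.apply ℝ 𝔤 v).hasFDerivAt.comp_hasDerivAt 0 hd
  have h6 : HasDerivAt (fun s ↦ ⁅b (s, ξ) v, b (s, ξ) w⁆)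
      (⁅deriv (fun t ↦ b (t, ξ)) 0 v, b (0, ξ) w⁆ + ⁅b (0, ξ) v, deriv (fun t ↦ b (t, ξ)) 0 w⁆) 0 :=
    ((bracketL 𝔤).hasFDerivAt.comp_hasDerivAt 0 (h5 v)).clm_apply (h5 w)
  have h7 := ((h4 v w).sub (h4 w v)).add h6
  exact (h7.congr_of_eventuallyEq (EventuallyEq.symm hflat)).unique (hasDerivAt_const 0 (0 : 𝔤))

variable (𝔤) in
/-- The affine action of `(a, b)` given by `f ↦ -[a, f] + b`, as a linear map on `𝔤 × ℝ`. -/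
noncomputable def affineAd : (𝔤 × 𝔤) →L[ℝ] (𝔤 × ℝ →L[ℝ] 𝔤 × ℝ) :=
  LinearMap.toContinuousLinearMap ((LinearMap.toContinuousLinearMap :
    (𝔤 × ℝ →ₗ[ℝ] 𝔤 × ℝ) ≃ₗ[ℝ] _).toLinearMap ∘ₗ
    LinearMap.mk₂ ℝ (fun (p : 𝔤 × 𝔤) (z : 𝔤 × ℝ) ↦ ((z.2 • p.2 - ⁅p.1, z.1⁆, 0) : 𝔤 × ℝ))
      (fun p q z ↦ by ext <;> simp; abel) (fun c p z ↦ by ext <;> simp [smul_sub, smul_comm c])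
      (fun p y z ↦ by ext <;> simp [add_smul]; abel)
      (fun c p z ↦ by ext <;> simp [smul_sub, mul_smul]))

/-- Up to sign `affineAd` represents the semidirect product of `𝔤` with its adjoint module. Hence
the curvature of the affine system splits into the Maurer-Cartan expression and its linearization.
-/
lemma affineAd_commutator (p q : 𝔤 × 𝔤) :
    affineAd 𝔤 q * affineAd 𝔤 p - affineAd 𝔤 p * affineAd 𝔤 q =
      affineAd 𝔤 (⁅p.1, q.1⁆, ⁅p.2, q.1⁆ + ⁅p.1, q.2⁆) := by
  refine ContinuousLinearMap.ext fun z ↦ Prod.ext ?_ ?_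
  · have h1 := leibniz_lie p.1 q.1 z.1
    have h2 := lie_skew p.2 q.1
    change ((0 : ℝ) • q.2 - ⁅q.1, z.2 • p.2 - ⁅p.1, z.1⁆⁆) -
      ((0 : ℝ) • p.2 - ⁅p.1, z.2 • q.2 - ⁅q.1, z.1⁆⁆) =
      z.2 • (⁅p.2, q.1⁆ + ⁅p.1, q.2⁆) - ⁅⁅p.1, q.1⁆, z.1⁆
    simp only [zero_smul, lie_sub, lie_smul, smul_add, h1, ← h2, smul_neg]
    abel
  · change (0 : ℝ) - 0 = 0
    simp

variable {m : ℕ} {M : Type*} [TopologicalSpace M] [ChartedSpace (EuclideanSpace ℝ (Fin m)) M]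
  [IsManifold (𝓡 m) ∞ M] [T2Space M]

/-- Tangent vectors of the space of Maurer-Cartan forms are smooth and satisfy the linearized
Maurer-Cartan equation. -/
lemma linearized_of_mem_tangent {α η : RoughOneForm m M 𝔤} (hη : η ∈ tangentMaurerCartan α)
    (i : M) : ContDiffOn ℝ ∞ (chartForm i η) (chartDom i) ∧
      ∀ ξ ∈ chartDom i, ∀ v w, flatExtDeriv (chartForm i η) ξ v w +
        (⁅chartForm i η ξ v, chartForm i α ξ w⁆ + ⁅chartForm i α ξ v, chartForm i η ξ w⁆) = 0 := by
  obtain ⟨ε, hε, β, hβ, rfl, hMC, hd⟩ := hη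
  have h0 : (0 : ℝ) ∈ Ioo (-ε) ε := by simp [hε]
  let b : ℝ × EuclideanSpace ℝ (Fin m) → EuclideanSpace ℝ (Fin m) →L[ℝ] 𝔤 :=
    fun p ↦ chartForm i (β p.1) p.2
  have hb : ∀ ξ ∈ chartDom i, ContDiffAt ℝ ∞ b (0, ξ) := fun ξ hξ ↦
    ((isSmoothCurveOfForms_iff ε β).1 hβ i).contDiffAt
      ((isOpen_Ioo.prod (isOpen_chartDom i)).mem_nhds ⟨h0, hξ⟩)
  have hl : ∀ ξ : EuclideanSpace ℝ (Fin m), HasDerivAt (fun t : ℝ ↦ (t, ξ)) (1, 0) 0 :=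
    fun ξ ↦ (hasDerivAt_id (0 : ℝ)).prodMk (hasDerivAt_const 0 ξ)
  have hbd : ∀ ξ ∈ chartDom i, HasDerivAt (fun t ↦ b (t, ξ)) (fderiv ℝ b (0, ξ) (1, 0)) 0 :=
    fun ξ hξ ↦ HasFDerivAt.comp_hasDerivAt (f := fun t : ℝ ↦ (t, ξ)) 0
      ((hb ξ hξ).differentiableAt (by simp)).hasFDerivAt (hl ξ)
  -- `η` is given only as a pointwise derivative; as a partial derivative of the smooth map `b` it
  -- becomes smooth.
  have hbη : ∀ ξ ∈ chartDom i, fderiv ℝ b (0, ξ) (1, 0) = chartForm i η ξ := by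
    intro ξ hξ
    ext v
    have h1 : HasDerivAt (fun t ↦ b (t, ξ) v) (fderiv ℝ b (0, ξ) (1, 0) v) 0 :=
      (ContinuousLinearMap.apply ℝ 𝔤 v).hasFDerivAt.comp_hasDerivAt 0 (hbd ξ hξ)
    exact h1.unique (hd (chartInv i ξ) (chartInvDeriv i ξ v))
  refine ⟨fun ξ hξ ↦ ?_, fun ξ hξ v w ↦ ?_⟩
  · have h1 : ContDiffAt ℝ ∞ (fun ξ ↦ fderiv ℝ b (0, ξ) (1, 0)) ξ :=
      (((hb ξ hξ).fderiv_right (m := ∞) (by simp)).comp ξ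
        (contDiffAt_const.prodMk contDiffAt_id)).clm_apply contDiffAt_const
    exact h1.contDiffWithinAt.congr (fun ζ hζ ↦ (hbη ζ hζ).symm) (hbη ξ hξ).symm
  · have h1 := linearized_flat (hb ξ hξ) v w (by
      filter_upwards [isOpen_Ioo.mem_nhds h0] with t ht
      exact ((mem_maurerCartanForms_iff _).1 (hMC t ht)).2 i ξ hξ v w)
    have h2 : (fun ζ ↦ deriv (fun t ↦ b (t, ζ)) 0) =ᶠ[𝓝 ξ] chartForm i η := by
      filter_upwards [(isOpen_chartDom i).mem_nhds hξ] with ζ hζ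
      rw [(hbd ζ hζ).deriv, hbη ζ hζ]
    rw [flatExtDeriv, h2.fderiv_eq, (hbd ξ hξ).deriv, hbη ξ hξ] at h1
    exact h1

/-- On a simply connected manifold, all tangent vectors of the space of Maurer-Cartan forms are
infinitesimal gauge transformations. -/
theorem exists_eq_gaugeVariation [SimplyConnectedSpace M] {α η : RoughOneForm m M 𝔤}
    (hα : α ∈ MaurerCartanForms) (hη : η ∈ tangentMaurerCartan α) :
    ∃ f : M → 𝔤, ContMDiff (𝓡 m) 𝓘(ℝ, 𝔤) ∞ f ∧ η = gaugeVariation α f := by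
  have : CompleteSpace 𝔤 := FiniteDimensional.complete ℝ 𝔤
  obtain ⟨x₀⟩ : Nonempty M := inferInstance
  obtain ⟨hαs, hαf⟩ := (mem_maurerCartanForms_iff α).1 hα
  rw [isSmoothOneForm_iff] at hαs
  -- The inhomogeneous equation `df = η - [α, f]` becomes linear after adding a real coordinate,
  -- which is to be constantly `1`; this explains the initial value `(0, 1)` below.
  let Θ : ∀ x : M, TangentSpace (𝓡 m) x →L[ℝ] (𝔤 × ℝ →L[ℝ] 𝔤 × ℝ) :=
    fun x ↦ (affineAd 𝔤).comp ((α x).prod (η x))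
  have hpair : ∀ i, ContDiffOn ℝ ∞ (fun ξ ↦ (chartForm i α ξ).prod (chartForm i η ξ))
      (chartDom i) := fun i ↦
    contDiff_clm_prod.comp_contDiffOn ((hαs i).prodMk (linearized_of_mem_tangent hη i).1)
  have hΘ : ∀ i, ContDiffOn ℝ ∞ (fun ξ ↦ (Θ (chartInv i ξ)).comp (chartInvDeriv i ξ))
      (chartDom i) := fun i ↦ by
    have h : ContDiffOn ℝ ∞ (fun ξ ↦ (affineAd 𝔤).comp
        ((chartForm i α ξ).prod (chartForm i η ξ))) (chartDom i) :=
      contDiffOn_const.clm_comp (hpair i)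
    exact h
  obtain ⟨F, hF0, hF, hFd⟩ := exists_parallel_section Θ hΘ (fun i ξ hξ v w ↦ by
    have hda : DifferentiableAt ℝ (chartForm i α) ξ :=
      ((hαs i).contDiffAt ((isOpen_chartDom i).mem_nhds hξ)).differentiableAt (by simp)
    have hdη : DifferentiableAt ℝ (chartForm i η) ξ :=
      ((linearized_of_mem_tangent hη i).1.contDiffAt
        ((isOpen_chartDom i).mem_nhds hξ)).differentiableAt (by simp)
    have hfd : ∀ v w, fderiv ℝ (fun ξ ↦ (Θ (chartInv i ξ)).comp (chartInvDeriv i ξ)) ξ v w =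
        affineAd 𝔤 (fderiv ℝ (chartForm i α) ξ v w, fderiv ℝ (chartForm i η) ξ v w) := by
      intro v w
      exact fderiv_comp_prod_apply (affineAd 𝔤) hda hdη v w
    have hα0 := hαf i ξ hξ v w
    have hη0 := (linearized_of_mem_tangent hη i).2 ξ hξ v w
    rw [flatExtDeriv] at hα0 hη0
    -- The curvature is `affineAd` of a pair whose entries vanish by flatness of `α` and by the
    -- linearized equation for `η`.
    rw [flatExtDeriv, hfd, hfd, add_sub_assoc]
    refine (congrArg (_ + ·) (affineAd_commutator (chartForm i α ξ v, chartForm i η ξ v)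
      (chartForm i α ξ w, chartForm i η ξ w))).trans ?_
    rw [← map_sub, ← map_add, Prod.mk_sub_mk, Prod.mk_add_mk, hα0, hη0]
    exact map_zero _) x₀ (0, 1)
  -- `Θ` takes values in operators with image in `𝔤 × 0`, so the real coordinate has zero
  -- derivative.
  have hsnd : IsLocallyConstant fun x ↦ (F x).2 := by
    refine (IsLocallyConstant.iff_eventually_eq _).2 fun y ↦ ?_
    have hyc := mem_chart_source (EuclideanSpace ℝ (Fin m)) y
    have hy := chart_mem_chartDom y hyc
    have hc := (contMDiff_iff_contDiffOn_chart F).1 hF y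
    have hdc : ∀ ξ ∈ chartDom y, HasFDerivAt (fun ξ ↦ (F (chartInv y ξ)).2)
        (0 : EuclideanSpace ℝ (Fin m) →L[ℝ] ℝ) ξ := by
      intro ξ hξ
      have h1 := (hc.contDiffAt ((isOpen_chartDom y).mem_nhds hξ)).differentiableAt (by simp)
      have h2 : HasFDerivAt (fun ξ ↦ (F (chartInv y ξ)).2) _ ξ :=
        (ContinuousLinearMap.snd ℝ 𝔤 ℝ).hasFDerivAt.comp ξ h1.hasFDerivAt
      convert! h2 using 1
      ext v
      change 0 = (fderiv ℝ (fun ξ ↦ F (chartInv y ξ)) ξ _).2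
      rw [← mfderiv_chartInvDeriv y F hξ h1, hFd]
      rfl
    have h3 := (isOpen_chartDom y).isOpen_inter_preimage_of_fderiv_eq_zero
      (fun ξ hξ ↦ (hdc ξ hξ).differentiableAt.differentiableWithinAt)
      (fun ξ hξ ↦ (hdc ξ hξ).fderiv) {(F y).2}
    have h4 := (continuousAt_extChartAt (I := 𝓡 m) y).eventually
      (h3.mem_nhds ⟨hy, by rw [mem_preimage, chartInv_chart y hyc]; rfl⟩)
    filter_upwards [h4, (chartAt _ y).open_source.mem_nhds hyc] with z hz hzs
    have h5 := hz.2
    rwa [mem_preimage, chartInv_chart y hzs] at h5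
  have hone : ∀ x, (F x).2 = 1 := fun x ↦ by
    rw [hsnd.apply_eq_of_preconnectedSpace x x₀, hF0]
  refine ⟨fun x ↦ (F x).1, contDiff_fst.contMDiff.comp hF, funext fun x ↦
    ContinuousLinearMap.ext fun v ↦ ?_⟩
  have h1 := mfderiv_comp x ((ContinuousLinearMap.fst ℝ 𝔤 ℝ).differentiableAt.mdifferentiableAt
    (x := F x)) ((hF x).mdifferentiableAt (by simp))
  rw [mfderiv_eq_fderiv, ContinuousLinearMap.fderiv] at h1
  have h2 : dirDeriv (fun x ↦ (F x).1) x v = η x v - ⁅α x v, (F x).1⁆ := by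
    refine (DFunLike.congr_fun h1 v).trans ((congrArg Prod.fst (hFd x v)).trans ?_)
    change (F x).2 • η x v - _ = _
    rw [hone, one_smul]
    rfl
  rw [gaugeVariation_apply, h2, sub_add_cancel]

end Tangent

end HorizontalForms

namespace HorizontalForms

open Filter Topology

/-! ### Singularity from simple loops: part (a) -/

section Singular

variable {m : ℕ} {M : Type*} [TopologicalSpace M] [ChartedSpace (EuclideanSpace ℝ (Fin m)) M]

/-- An integrable function on a simple loop that is orthogonal to the restrictions of all smooth
functions has vanishing integral over all subintervals. -/
lemma intervalIntegral_eq_zero_of_forall_smooth [IsManifold (𝓡 m) ∞ M] [T2Space M]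
    [SigmaCompactSpace M] {γ : ℝ → M}
    (hγ : ContinuousOn γ (Icc 0 1)) (hloop : IsSimpleLoop γ) {u : ℝ → ℝ}
    (hu : IntervalIntegrable u volume 0 1)
    (h : ∀ h : M → ℝ, ContMDiff (𝓡 m) 𝓘(ℝ, ℝ) ∞ h → ∫ t in (0 : ℝ)..1, h (γ t) * u t = 0)
    {a b : ℝ} (ha : 0 < a) (hab : a ≤ b) (hb : b < 1) : ∫ t in a..b, u t = 0 := by
  let δ : ℕ → ℝ := fun n ↦ 1 / (n + 1)
  have hδ : ∀ n, 0 < δ n := fun n ↦ by positivity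
  have hδ0 : Tendsto δ atTop (𝓝 0) := tendsto_one_div_add_atTop_nhds_zero_nat
  have hT : IsClosed (γ '' Icc a b) :=
    (isCompact_Icc.image_of_continuousOn (hγ.mono (Icc_subset_Icc ha.le hb.le))).isClosed
  have hS : ∀ n, IsClosed (γ '' (Icc 0 (a - δ n) ∪ Icc (b + δ n) 1)) := fun n ↦
    ((isCompact_Icc.union isCompact_Icc).image_of_continuousOn (hγ.mono (union_subset
      (Icc_subset_Icc le_rfl (by linarith [hδ n]))
      (Icc_subset_Icc (by linarith [hδ n]) le_rfl)))).isClosed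
  have hdisj : ∀ n, Disjoint (γ '' (Icc 0 (a - δ n) ∪ Icc (b + δ n) 1)) (γ '' Icc a b) := by
    intro n
    rw [disjoint_left]
    rintro _ ⟨t, ht, rfl⟩ ⟨s, hs, hst⟩
    have hs' : s ∈ Ico (0 : ℝ) 1 := ⟨by linarith [hs.1], by linarith [hs.2]⟩
    have hn := hδ n
    -- Injectivity holds only on `[0, 1)`, so the endpoint `1` is replaced by `0`, which lies
    -- outside `[a, b]` because `0 < a`.
    by_cases ht1 : t = 1
    · rw [ht1, ← hloop.1] at hst
      have := hloop.2 hs' ⟨le_rfl, one_pos⟩ hst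
      linarith [hs.1]
    · have ht' : t ∈ Ico (0 : ℝ) 1 := by
        rcases ht with ht | ht
        · exact ⟨ht.1, by linarith [ht.2]⟩
        · exact ⟨by linarith [ht.1], lt_of_le_of_ne ht.2 ht1⟩
      have := hloop.2 hs' ht' hst
      rcases ht with ht | ht
      · linarith [ht.2, hs.1]
      · linarith [ht.1, hs.2]
  -- Smooth Urysohn functions: `g n ∘ γ` takes values in `[0, 1]`, is `1` on `[a, b]` and vanishes
  -- outside the `δ n`-neighbourhood. By dominated convergence the integrals tend to that of `u`
  -- over `[a, b]`.
  choose g hg0 hg1 hg using fun n ↦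
    exists_contMDiffMap_zero_one_of_isClosed (n := ⊤) (𝓡 m) (hS n) hT (hdisj n)
  have hint : ∀ n, IntervalIntegrable (fun t ↦ g n (γ t) * u t) volume 0 1 := fun n ↦
    hu.continuousOn_mul (((g n).contMDiff.continuous).comp_continuousOn
      (by rwa [uIcc_of_le zero_le_one]))
  have hlim := intervalIntegral.tendsto_integral_filter_of_dominated_convergence (μ := volume)
    (a := 0) (b := 1) (l := atTop) (F := fun n t ↦ g n (γ t) * u t) (f := (Icc a b).indicator u)
    (fun t ↦ ‖u t‖) (Eventually.of_forall fun n ↦ (hint n).def'.aestronglyMeasurable)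
    (Eventually.of_forall fun n ↦ Eventually.of_forall fun t _ ↦ by
      rw [norm_mul]
      refine mul_le_of_le_one_left (norm_nonneg _) ?_
      rw [Real.norm_of_nonneg (hg n _).1]
      exact (hg n _).2) hu.norm
    (Eventually.of_forall fun t ht ↦ by
      rw [uIoc_of_le zero_le_one] at ht
      by_cases htab : t ∈ Icc a b
      · refine tendsto_const_nhds.congr fun n ↦ ?_
        rw [indicator_of_mem htab, hg1 n (mem_image_of_mem γ htab), Pi.one_apply, one_mul]
      · rw [indicator_of_notMem htab]
        have hev : ∀ᶠ n in atTop, t ∈ Icc 0 (a - δ n) ∪ Icc (b + δ n) 1 := by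
          rcases lt_or_ge t a with hta | hta
          · filter_upwards [hδ0.eventually (gt_mem_nhds (sub_pos.2 hta))] with n hn
            exact Or.inl ⟨ht.1.le, by linarith⟩
          · have htb : b < t := not_le.1 fun h ↦ htab ⟨hta, h⟩
            filter_upwards [hδ0.eventually (gt_mem_nhds (sub_pos.2 htb))] with n hn
            exact Or.inr ⟨by linarith, ht.2⟩
        refine tendsto_const_nhds.congr' ?_
        filter_upwards [hev] with n hn
        rw [hg0 n (mem_image_of_mem γ hn), Pi.zero_apply, zero_mul])
  have h0 := tendsto_nhds_unique hlim
    (tendsto_const_nhds.congr fun n ↦ (h _ (g n).contMDiff).symm)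
  rw [intervalIntegral.integral_of_le zero_le_one, integral_indicator measurableSet_Icc,
    Measure.restrict_restrict measurableSet_Icc, inter_eq_left.2 (Icc_subset_Ioc ha hb.le),
    integral_Icc_eq_integral_Ioc] at h0
  rwa [intervalIntegral.integral_of_le hab]

variable {𝔤 : Type*} [NormedLieRing 𝔤] [NormedLieAlgebra 𝔤]

lemma deriv_comp_curve (C : 𝔤 →L[ℝ] ℝ) {f : M → 𝔤} (hf : ContMDiff (𝓡 m) 𝓘(ℝ, 𝔤) ∞ f)
    {γ : ℝ → M} {t : ℝ} (hγ : MDifferentiableAt 𝓘(ℝ, ℝ) (𝓡 m) γ t) :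
    deriv ((C ∘ f) ∘ γ) t = C (dirDeriv (m := m) f (γ t) (velocity γ t)) := by
  have h1 := mfderiv_comp t ((hf (γ t)).mdifferentiableAt (by simp)) hγ
  have h2 := mfderiv_comp t (C.differentiableAt.mdifferentiableAt (x := (f ∘ γ) t))
    (((hf (γ t)).mdifferentiableAt (by simp)).comp t hγ)
  rw [mfderiv_eq_fderiv, mfderiv_eq_fderiv, C.fderiv, h1] at h2
  rw [← fderiv_apply_one_eq_deriv]
  exact DFunLike.congr_fun h2 1

variable [IsManifold (𝓡 m) ∞ M]

lemma isSmoothOneForm_differentialForm {f : M → 𝔤} (hf : ContMDiff (𝓡 m) 𝓘(ℝ, 𝔤) ∞ f) :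
    IsSmoothOneForm (differentialForm (m := m) f) :=
  (isSmoothOneForm_iff _).2 fun x₀ ↦
    (((contMDiff_iff_contDiffOn_chart f).1 hf x₀).fderiv_of_isOpen (isOpen_chartDom x₀)
      (by simp)).congr fun _ hξ ↦ chartForm_differentialForm hf x₀ hξ

/-- A smooth function times the restriction of the differential of a smooth function is a smooth
partial form. -/
lemma isSmoothPartialForm_smul_differentialForm
    (D : ∀ x : M, Submodule ℝ (TangentSpace (𝓡 m) x)) (𝔢 : Submodule ℝ 𝔤) [FiniteDimensional ℝ 𝔤]
    {h : M → ℝ} (hh : ContMDiff (𝓡 m) 𝓘(ℝ, ℝ) ∞ h) {f : M → 𝔤}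
    (hf : ContMDiff (𝓡 m) 𝓘(ℝ, 𝔤) ∞ f) :
    IsSmoothPartialForm D 𝔢 fun x ↦ h x • restrictMod D 𝔢 (differentialForm f) x := by
  intro X hX c
  have h1 := contMDiff_apply_field (isSmoothOneForm_differentialForm hf) hX
  have h2 := (LinearMap.toContinuousLinearMap (c ∘ₗ 𝔢.mkQ)).contDiff.contMDiff.comp h1
  refine (hh.mul h2).congr fun x ↦ ?_
  exact map_smul c (h x) _

variable [T2Space M] [SecondCountableTopology M] [SimplyConnectedSpace M] [FiniteDimensional ℝ 𝔤]

/-- Regularity would put every `h dG` modulo `𝔢` in the image of the tangent space, whose elements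
have zero integral around the loop. Localizing with `h` then contradicts the choice of `G`. -/
theorem isSingular_of_simpleLoop (D : ∀ x : M, Submodule ℝ (TangentSpace (𝓡 m) x))
    {𝔢 : Submodule ℝ 𝔤} (hcodim : 0 < Module.finrank ℝ (𝔤 ⧸ 𝔢)) {α : RoughOneForm m M 𝔤}
    (hα : α ∈ MaurerCartanForms) {γ : ℝ → M} (hγ : IsHorizontalCurve D γ) (hloop : IsSimpleLoop γ)
    (hαγ : ∀ᵐ t ∂(volume.restrict (Icc (0 : ℝ) 1)), α (γ t) (velocity γ t) = 0) :
    IsSingular D 𝔢 α := by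
  intro hreg
  have : LocallyCompactSpace M := ChartedSpace.locallyCompactSpace (EuclideanSpace ℝ (Fin m)) M
  let B := Module.finBasis ℝ (𝔤 ⧸ 𝔢)
  obtain ⟨Z, hZ⟩ := 𝔢.mkQ_surjective (B ⟨0, hcodim⟩)
  -- A functional vanishing on `𝔢` with `C Z = 1`; it exists because the codimension is positive,
  -- and it turns identities modulo `𝔢` into scalar ones.
  let C : 𝔤 →L[ℝ] ℝ := LinearMap.toContinuousLinearMap (B.coord ⟨0, hcodim⟩ ∘ₗ 𝔢.mkQ)
  have hCZ : C Z = 1 := by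
    change B.coord ⟨0, hcodim⟩ (𝔢.mkQ Z) = 1
    rw [hZ, Module.Basis.coord_apply, Module.Basis.repr_self, Finsupp.single_eq_same]
  have hsep : γ (1 / 3) ≠ γ (2 / 3) := fun h ↦ by
    have := hloop.2 (show (1 / 3 : ℝ) ∈ Ico 0 1 by norm_num)
      (show (2 / 3 : ℝ) ∈ Ico 0 1 by norm_num) h
    norm_num at this
  -- The values `0` and `1` of `g` at two interior times of the loop will be incompatible with the
  -- vanishing of the integral of `(g ∘ γ)'` between them.
  obtain ⟨g, hg0, hg1, -⟩ := exists_contMDiffMap_zero_one_of_isClosed (n := ⊤) (𝓡 m)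
    (isClosed_singleton (x := γ (1 / 3))) (isClosed_singleton (x := γ (2 / 3)))
    (disjoint_singleton.2 hsep)
  let G : M → 𝔤 := fun x ↦ g x • Z
  have hG : ContMDiff (𝓡 m) 𝓘(ℝ, 𝔤) ∞ G := g.contMDiff.smul contMDiff_const
  have hCG : C ∘ G = g := funext fun x ↦ by
    simp only [G, Function.comp_apply, map_smul, hCZ, smul_eq_mul, mul_one]
  have hAC := hγ.1.2 (C ∘ G) (C.contDiff.contMDiff.comp hG)
  have horth : ∀ h : M → ℝ, ContMDiff (𝓡 m) 𝓘(ℝ, ℝ) ∞ h →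
      ∫ t in (0 : ℝ)..1, h (γ t) * deriv ((C ∘ G) ∘ γ) t = 0 := by
    intro h hh
    obtain ⟨η, hη, hηφ⟩ := hreg _ (isSmoothPartialForm_smul_differentialForm D 𝔢 hh hG)
    obtain ⟨f, hf, rfl⟩ := exists_eq_gaugeVariation hα hη
    have hfAC := hγ.1.2 (C ∘ f) (C.contDiff.contMDiff.comp hf)
    have h1 := hfAC.integral_deriv_eq_sub
    rw [Function.comp_apply (f := C ∘ f) (g := γ), Function.comp_apply (f := C ∘ f) (g := γ),
      ← hloop.1, sub_self] at h1
    refine Eq.trans ?_ h1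
    refine intervalIntegral.integral_congr_ae ?_
    rw [uIoc_of_le zero_le_one]
    filter_upwards [(ae_restrict_iff' measurableSet_Icc).1 hγ.2,
      (ae_restrict_iff' measurableSet_Icc).1 hαγ] with t ht1 ht2 ht
    obtain ⟨hd, hD⟩ := ht1 (Ioc_subset_Icc_self ht)
    rw [deriv_comp_curve C hG hd, deriv_comp_curve C hf hd]
    have h2 := DFunLike.congr_fun (congrFun hηφ (γ t)) ⟨velocity γ t, hD⟩
    have h3 : 𝔢.mkQ (gaugeVariation α f (γ t) (velocity γ t)) =
      h (γ t) • 𝔢.mkQ (dirDeriv G (γ t) (velocity γ t)) := h2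
    -- Since `α` annihilates the velocity, the bracket term drops out and only the exact term `df`
    -- remains; its integral over the closed curve is zero.
    rw [gaugeVariation_apply, ht2 (Ioc_subset_Icc_self ht), zero_lie, add_zero] at h3
    have h4 := congrArg (B.coord ⟨0, hcodim⟩) h3
    rw [map_smul] at h4
    exact h4.symm
  have h0 := intervalIntegral_eq_zero_of_forall_smooth hγ.1.1 hloop hAC.intervalIntegrable_deriv
    horth (a := 1 / 3) (b := 2 / 3) (by norm_num) (by norm_num) (by norm_num)
  have hAC' : AbsolutelyContinuousOnInterval ((C ∘ G) ∘ γ) (1 / 3) (2 / 3) := hAC.mono (by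
    rw [uIcc_of_le (by norm_num), uIcc_of_le (by norm_num)]
    exact Icc_subset_Icc (by norm_num) (by norm_num))
  rw [hAC'.integral_deriv_eq_sub, hCG, Function.comp_apply, Function.comp_apply,
    hg0 (mem_singleton _), hg1 (mem_singleton _)] at h0
  norm_num at h0

end Singular

end HorizontalForms

theorem proposition3p5 {m k : ℕ} (hk : 2 ≤ k)
    {M : Type*} [TopologicalSpace M] [T2Space M] [SecondCountableTopology M]
    [ChartedSpace (EuclideanSpace ℝ (Fin m)) M] [IsManifold (𝓡 m) ∞ M] [SimplyConnectedSpace M]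
    (S : HorizontalForms.SubRiemannianStructure m M k)
    {𝔤 : Type*} [HorizontalForms.NormedLieRing 𝔤] [HorizontalForms.NormedLieAlgebra 𝔤]
    [FiniteDimensional ℝ 𝔤]
    (𝔢 : Submodule ℝ 𝔤) (hgen : HorizontalForms.IsGenerating 𝔢)
    (hcodim : 0 < Module.finrank ℝ (𝔤 ⧸ 𝔢))
    (α : HorizontalForms.RoughOneForm m M 𝔤)
    (hα : α ∈ HorizontalForms.HorizontalMaurerCartanForms S.D 𝔢) :
    ((∃ γ : ℝ → M, HorizontalForms.IsHorizontalCurve S.D γ ∧ HorizontalForms.IsSimpleLoop γ ∧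
        ∀ᵐ t ∂(volume.restrict (Icc (0 : ℝ) 1)),
          α (γ t) (HorizontalForms.velocity γ t) = 0) →
      HorizontalForms.IsSingular S.D 𝔢 α) ∧
    (HorizontalForms.IsStronglyBracketGenerating k 𝔢 →
      (∀ x, ∀ v ∈ S.D x, α x v = 0 → v = 0) →
      HorizontalForms.IsRegular S.D 𝔢 α) := by
  refine ⟨?_, fun hstrong hinj ↦ HorizontalForms.isRegular_of_isStronglyBracketGenerating
    (one_le_two.trans hk) S hα hstrong hinj⟩
  rintro ⟨γ, hγ, hloop, hαγ⟩
  exact HorizontalForms.isSingular_of_simpleLoop S.D hcodim hα.1 hγ hloop hαγ
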